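/- Let $n,m\in\mathbb N$ and let $\mathcal K_1,\dots,\mathcal K_m$ be non-empty subsets of $[n]=\{1,\dots,n\}$. Define the symmetric matrix $\epsilon=(\epsilon_{i,j})_{i,j=1}^m$ by $\epsilon_{i,j}=1$ if $\mathcal K_i\cap\mathcal K_j=\emptyset$ and $\epsilon_{i,j}=0$ otherwise. For a word $\boldsymbol\iota=(\iota_1,\dots,\iota_k):[k]\to[m]$, let $\mathcal{NC}_2^{(\epsilon,\boldsymbol\iota)}(k)$ be the set of all pair partitions $\alpha$ of $[k]$ (all blocks have exactly two elements) such that $\iota_i=\iota_j$ whenever $i\sim_\alpha j$, and such that $\epsilon_{\iota_i,\iota_p}=1$ whenever $1\le i<p<j<q\le k$ and $i\sim_\alpha j\nsim_\alpha p\sim_\alpha q$. A $D\times D$ GUE random matrix is a random Hermitian matrix $G=(g_{i,j})$ for which $\{\mathrm{Re}\,g_{i,j}\}_{i\ge j}\cup\{\mathrm{Im}\,g_{i,j}\}_{i>j}$ are independent, $g_{i,i}\sim N(0,1/D)$, and, for $i>j$, $\mathrm{Re}\,g_{i,j}$ and $\mathrm{Im}\,g_{i,j}$ have law $N(0,1/(2D))$;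 thus $\mathbb E|g_{i,j}|^2=1/D$ for all $i,j$. On one probability space let, for every $d\in\mathbb N$, $G_1^{(d)},\dots,G_m^{(d)}$ be independent GUE random matrices, with $G_\iota^{(d)}\in\bigotimes_{s\in\mathcal K_\iota}\mathbb M_d(\mathbb C)$ of size $D=d^{\#\mathcal K_\iota}$; nothing is assumed about the joint law for different $d$. Put $H_\iota=H_\iota^{(d)}=G_\iota^{(d)}\otimes\bigotimes_{s\notin\mathcal K_\iota}1_d\in\mathbb M_{d^n}(\mathbb C)$ and let $\mathrm{tr}=d^{-n}\,\mathrm{Tr}$ be the normalized trace. Then almost surely, for every $k\ge 0$ and every word $\boldsymbol\iota:[k]\to[m]$, $$\lim_{d\to\infty}\mathrm{tr}\left(H_{\iota_1}\cdots H_{\iota_k}\right)=\#\,\mathcal{NC}_2^{(\epsilon,\boldsymbol\iota)}(k).$$ Moreover, for every word $\boldsymbol\iota:[k]\to[m]$, the random variable $\mathrm{tr}(H_{\iota_1}\cdots H_{\iota_k})$ is square integrable for every $d$, and its variance satisfies $$\mathbb E\left|\mathrm{tr}(H_{\iota_1}\cdots H_{\iota_k})-\mathbb E\,\mathrm{tr}(H_{\iota_1}\cdots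 H_{\iota_k})\right|^2=O(d^{-2})\qquad(d\to\infty).$$ -/

import Mathlib

open MeasureTheory ProbabilityTheory Filter Topology Asymptotics
open scoped NNReal

/-- The symmetric `0`-`1` matrix `ε` attached to the sets of sites `K 1, …, K m`:
`ε i j = 1` if `K i ∩ K j = ∅`, and `ε i j = 0` otherwise. -/
def epsilonMatrix {n m : ℕ} (K : Fin m → Finset (Fin n)) : Matrix (Fin m) (Fin m) ℕ :=
  Matrix.of fun i j => if K i ∩ K j = ∅ then 1 else 0

open Classical in
/-- The kernel of a word `w : [k] → [m]`: the partition of `[k]` in which `i` and `j` share a block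
iff `w i = w j`. -/
noncomputable def wordKer {k m : ℕ} (w : Fin k → Fin m) :
    Finpartition (Finset.univ : Finset (Fin k)) :=
  Finpartition.ofSetoid (Setoid.ker w)

/-- `α` is `(ε, w)`-noncrossing: whenever `i < p < j < q` with `i ∼ j`, `p ∼ q` and `i ≁ p`
(a crossing of two different blocks), the letters satisfy `ε (w i) (w p) = 1`. -/
def IsEpsNoncrossing {k m : ℕ} (ε : Matrix (Fin m) (Fin m) ℕ) (w : Fin k → Fin m)
    (α : Finpartition (Finset.univ : Finset (Fin k))) : Prop :=
  ∀ i p j q : Fin k, i < p → p < j → j < q →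
    α.part i = α.part j → α.part j ≠ α.part p → α.part p = α.part q → ε (w i) (w p) = 1

open Classical in
/-- The set of all `(ε, w)`-noncrossing partitions of `[k]` that refine `ker w`. -/
noncomputable def epsNC {k m : ℕ} (ε : Matrix (Fin m) (Fin m) ℕ) (w : Fin k → Fin m) :
    Finset (Finpartition (Finset.univ : Finset (Fin k))) :=
  Finset.univ.filter fun α => α ≤ wordKer w ∧ IsEpsNoncrossing ε w α

open Classical in
/-- The pair partitions among the `(ε, w)`-noncrossing partitions of `[k]` that refine `ker w`. -/
noncomputable def epsNC₂ {k m : ℕ} (ε : Matrix (Fin m) (Fin m) ℕ) (w : Fin k → Fin m) :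
    Finset (Finpartition (Finset.univ : Finset (Fin k))) :=
  (epsNC ε w).filter fun α => ∀ B ∈ α.parts, B.card = 2

/-- `G` is a (normalized) GUE random matrix of size `D = card N`: it is Hermitian, its diagonal
entries are real Gaussians `N(0, 1/D)`, its off-diagonal entries have real and imaginary parts
`N(0, 1/(2D))` (so that `E |g i j|² = 1/D` for all `i, j`), and the variables `Re g i j`, `j ≤ i`,
together with `Im g i j`, `j < i`, are independent. -/
structure IsGUE {Ω N : Type*} [MeasurableSpace Ω] [Fintype N] [LinearOrder N]
    (G : Ω → Matrix N N ℂ) (P : Measure Ω) : Prop where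
  measurable : ∀ i j, Measurable fun ω => G ω i j
  isHermitian : ∀ ω, (G ω).IsHermitian
  law_diag : ∀ i, HasLaw (fun ω => (G ω i i).re) (gaussianReal 0 (1 / (Fintype.card N : ℝ≥0))) P
  law_re : ∀ i j, j < i →
    HasLaw (fun ω => (G ω i j).re) (gaussianReal 0 (1 / (2 * (Fintype.card N : ℝ≥0)))) P
  law_im : ∀ i j, j < i →
    HasLaw (fun ω => (G ω i j).im) (gaussianReal 0 (1 / (2 * (Fintype.card N : ℝ≥0)))) P
  indep : iIndepFun
    (fun (x : {p : N × N // p.2 ≤ p.1} ⊕ {p : N × N // p.2 < p.1}) (ω : Ω) =>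
      Sum.elim (fun p => (G ω p.1.1 p.1.2).re) (fun p => (G ω p.1.1 p.1.2).im) x) P

/-- The indices of the standard basis of `⨂_{s ∈ A} ℂ^d`: tuples `(i s)_{s ∈ A}` with `i s ∈ [d]`
(ordered lexicographically). -/
abbrev SiteIndex {n : ℕ} (A : Finset (Fin n)) (d : ℕ) : Type := Lex (A → Fin d)

/-- The matrix `X ⊗ ⨂_{s ∉ A} 1_d` on `(ℂ^d)^{⊗ n}`, for `X` acting on the sites in `A`. Its entry
at the `n`-tuples `i, j` is that of `X` at the restrictions of `i, j` to `A`, times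
`∏_{s ∉ A} δ_{i s, j s}`. -/
def localTerm {n d : ℕ} (A : Finset (Fin n)) (X : Matrix (SiteIndex A d) (SiteIndex A d) ℂ) :
    Matrix (Fin n → Fin d) (Fin n → Fin d) ℂ :=
  Matrix.of fun i j =>
    X (toLex fun s : A => i s) (toLex fun s : A => j s) * ∏ s ∈ Aᶜ, if i s = j s then 1 else 0

/-- The normalized trace `tr = Tr / D` of a matrix of size `D = card N`. -/
noncomputable def normTrace {N : Type*} [Fintype N] (A : Matrix N N ℂ) : ℂ :=
  A.trace / (Fintype.card N : ℂ)

/-- The normalized trace `tr (H (w 1) ⋯ H (w k))` of a word in the matrices `H 1, …, H m`. -/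
noncomputable def wordTrace {N : Type*} [Fintype N] [DecidableEq N] {k m : ℕ}
    (H : Fin m → Matrix N N ℂ) (w : Fin k → Fin m) : ℂ :=
  normTrace (List.ofFn fun l => H (w l)).prod

/-! Let γ be the cyclic rotation of the letters of a word. Expanding the trace into matrix entries
and applying Wick's formula (`eq_sum_pairingsOn_of_recursion`) gives a sum over pairings σ of the
letters. The covariance of two entries of local terms is a product over the `n` sites: at a site of
`K a` the indices are matched crosswise, as for a GUE matrix; at any other site each entry is a
Kronecker delta. Hence the index sum belonging to σ factors over the sites. Let σ_s be the
restriction of σ to the letters whose set of sites contains s (`restrictPerm`). Site s contributes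
the number of colourings with `d` colours that are constant along the cycles of γσ_s, divided by `d`
to the power |supp σ_s| / 2 (`pairWeight`, `integral_cyclicSum`).

Multiplying by a transposition splits a cycle or merges two, so it multiplies or divides the number
of colourings by `d`. A site therefore contributes at most `d`. It contributes exactly `d` if σ_s is
noncrossing, and at most 1 if two pairs of σ_s cross: the first cuts the circle into two arcs and
the second glues them together again. Two crossing pairs are both visible at some site exactly when
their sets of sites meet, so "every σ_s is noncrossing" is the ε-noncrossing condition
(`card_epsNC₂`). After division by `d ^ n` these pairings have weight 1 and the others vanish in the
limit.

The conjugate of a cyclic sum is a cyclic sum along γ⁻¹, so the variance is a covariance of two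
circles, to which only pairings linking the circles contribute (`integral_cyclicSum_mul_sub`). Since
the sets `K a` are nonempty, a linking pair is visible at some site; it merges the two circles there
and lowers the bound at that site from `d ^ 2` to 1. This gives `variance_wordTrace_le`. Variances
of order `d⁻²` are summable, and almost sure convergence follows whatever the joint law for
different `d`. -/

open Equiv.Perm

set_option linter.unusedSectionVars false

/-- The number of `Fin d`-valued functions that are constant along the cycles of `f`. -/
def invariantCount {ι : Type*} [Fintype ι] [DecidableEq ι] (f : Equiv.Perm ι) (d : ℕ) : ℕ :=
  (Finset.univ.filter fun x : ι → Fin d => ∀ l, x (f l) = x l).card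

/-! ### Colourings constant along cycles, and multiplication by a transposition -/

section Cycles

variable {ι : Type*} [Fintype ι] [DecidableEq ι]

lemma apply_eq_of_sameCycle {α : Type*} {f : Equiv.Perm ι} {x : ι → α} (hx : ∀ l, x (f l) = x l)
    {a b : ι} (h : f.SameCycle a b) : x a = x b := by
  obtain ⟨i, rfl⟩ := h.exists_nat_pow_eq
  induction i with
  | zero => rfl
  | succ i ih => rw [pow_succ', Equiv.Perm.mul_apply, hx]; exact ih ⟨i, rfl⟩

/-- Merging: the new permutation sends a to `f b` and then follows the `f`-cycle of b, which avoids
a, until it arrives at b. -/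
lemma sameCycle_mul_swap_of_not_sameCycle {f : Equiv.Perm ι} {a b : ι} (h : ¬ f.SameCycle a b) :
    (f * Equiv.swap a b).SameCycle a b := by
  by_contra hg
  have key : ∀ j : ℕ, ((f * Equiv.swap a b) ^ (j + 1)) a = (f ^ (j + 1)) b := by
    intro j
    induction j with
    | zero => simp
    | succ j ih =>
      rw [pow_succ', Equiv.Perm.mul_apply, ih, Equiv.Perm.mul_apply, Equiv.swap_apply_of_ne_of_ne,
        pow_succ' f (j + 1), Equiv.Perm.mul_apply]
      · intro hja
        exact h (SameCycle.symm ⟨(j + 1 : ℕ), by rw [zpow_natCast]; exact hja⟩)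
      · intro hjb
        exact hg ⟨(j + 1 : ℕ), by rw [zpow_natCast, ih]; exact hjb⟩
  have h0 := orderOf_pos f
  have h1 := key (orderOf f - 1)
  rw [Nat.sub_add_cancel h0, pow_orderOf_eq_one, Equiv.Perm.one_apply] at h1
  exact hg ⟨(orderOf f : ℕ), by rw [zpow_natCast]; exact h1⟩

lemma not_sameCycle_of_invariant {f : Equiv.Perm ι} {T : Set ι} (hT : ∀ l ∈ T, f l ∈ T) {a b : ι}
    (ha : a ∈ T) (hb : b ∉ T) : ¬ f.SameCycle a b := by
  intro h
  obtain ⟨i, rfl⟩ := h.exists_nat_pow_eq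
  refine hb ?_
  clear hb h
  induction i with
  | zero => simpa using ha
  | succ i ih => rw [pow_succ', Equiv.Perm.mul_apply]; exact hT _ ih

/-- Splitting: the arc of the cycle from `f b` to a closes up, because a is now sent to `f b`, and b
is left outside it. -/
lemma not_sameCycle_mul_swap_of_sameCycle {f : Equiv.Perm ι} {a b : ι} (hab : a ≠ b)
    (h : f.SameCycle a b) : ¬ (f * Equiv.swap a b).SameCycle a b := by
  classical
  have hex : ∃ j : ℕ, (f ^ j) b = a := h.symm.exists_nat_pow_eq
  have hmin : ∀ j : ℕ, (f ^ j) b = a → Nat.find hex ≤ j := fun j hj => Nat.find_min' hex hj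
  have hspec := Nat.find_spec hex
  generalize Nat.find hex = N at hmin hspec
  have hN : 1 ≤ N := by
    rcases Nat.eq_zero_or_pos N with h0 | h0
    · subst h0; exact absurd hspec.symm (by simpa using hab)
    · exact h0
  have hb : ∀ j, 1 ≤ j → j ≤ N → (f ^ j) b ≠ b := by
    intro j h1 h2 h3
    have : (f ^ (N - j)) b = a := by
      rw [← hspec, ← Nat.sub_add_cancel h2, pow_add, Equiv.Perm.mul_apply, h3,
        Nat.sub_add_cancel h2]
    have := hmin _ this
    omega
  -- `N` is the first time at which the orbit of b reaches a; minimality keeps b off the arc T.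
  refine not_sameCycle_of_invariant (T := {l | ∃ j, 1 ≤ j ∧ j ≤ N ∧ (f ^ j) b = l}) ?_
    ⟨N, hN, le_rfl, hspec⟩ ?_
  · rintro l ⟨j, h1, h2, rfl⟩
    rcases eq_or_lt_of_le h2 with rfl | h3
    · exact ⟨1, le_rfl, hN, by simp [hspec]⟩
    · refine ⟨j + 1, by omega, h3, ?_⟩
      rw [Equiv.Perm.mul_apply, Equiv.swap_apply_of_ne_of_ne, pow_succ', Equiv.Perm.mul_apply]
      · intro h4; have := hmin _ h4; omega
      · exact hb j h1 h2
  · rintro ⟨j, h1, h2, h3⟩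
    exact hb j h1 h2 h3

/-- Colourings with equal values at a and b do not see the transposition. They are the common term
through which the counts for `f` and `f * swap a b` are compared, so cycles never have to be
counted. -/
lemma invariant_mul_swap_iff {α : Type*} (f : Equiv.Perm ι) {a b : ι} {x : ι → α}
    (hx : x a = x b) :
    (∀ l, x ((f * Equiv.swap a b) l) = x l) ↔ ∀ l, x (f l) = x l := by
  have hs : ∀ l, x (Equiv.swap a b l) = x l := by
    intro l
    rw [Equiv.swap_apply_def]
    split_ifs with h1 h2
    · rw [h1, hx]
    · rw [h2, hx]
    · rfl
  constructor
  · intro h l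
    have := h (Equiv.swap a b l)
    rwa [Equiv.Perm.mul_apply, Equiv.swap_apply_self, hs] at this
  · intro h l
    rw [Equiv.Perm.mul_apply, h, hs]

lemma invariantCount_of_sameCycle {f : Equiv.Perm ι} {a b : ι} (h : f.SameCycle a b) (d : ℕ) :
    invariantCount f d =
      (Finset.univ.filter fun x : ι → Fin d => (∀ l, x (f l) = x l) ∧ x a = x b).card := by
  unfold invariantCount
  congr 1
  ext x
  simp only [Finset.mem_filter, Finset.mem_univ, true_and]
  exact ⟨fun hx => ⟨hx, apply_eq_of_sameCycle hx h⟩, fun hx => hx.1⟩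

lemma invariantCount_of_not_sameCycle {f : Equiv.Perm ι} {a b : ι} (h : ¬ f.SameCycle a b)
    (d : ℕ) : invariantCount f d =
      (Finset.univ.filter fun x : ι → Fin d => (∀ l, x (f l) = x l) ∧ x a = x b).card * d := by
  classical
  unfold invariantCount
  have hprod : ∀ M : Finset (ι → Fin d),
      M.card * d = (M ×ˢ (Finset.univ : Finset (Fin d))).card := fun M => by
    rw [Finset.card_product, Finset.card_fin]
  rw [hprod]
  have hba : ¬ f.SameCycle b a := fun h' => h h'.symm
  -- Recolour the cycle of b with the colour of a, and record the old colour of b as the extra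
  -- factor `d`.
  refine Finset.card_nbij' (fun x => (fun l => if f.SameCycle b l then x a else x l, x b))
    (fun y l => if f.SameCycle b l then y.2 else y.1 l) ?_ ?_ ?_ ?_
  · intro x hx
    simp only [Finset.coe_filter, Finset.mem_univ, true_and, Set.mem_ofPred_eq] at hx
    simp only [Finset.coe_product, Finset.coe_filter, Finset.mem_univ, true_and, Finset.coe_univ,
      Set.mem_prod, Set.mem_ofPred_eq, Set.mem_univ, and_true, sameCycle_apply_right, hx,
      implies_true, SameCycle.refl, if_true, hba, if_false]
  · intro y hy
    simp only [Finset.coe_product, Finset.coe_filter, Finset.mem_univ, true_and, Finset.coe_univ,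
      Set.mem_prod, Set.mem_ofPred_eq, Set.mem_univ, and_true] at hy
    simp only [Finset.coe_filter, Finset.mem_univ, true_and, Set.mem_ofPred_eq,
      sameCycle_apply_right, hy.1, implies_true]
  · intro x hx
    simp only [Finset.coe_filter, Finset.mem_univ, true_and, Set.mem_ofPred_eq] at hx
    funext l
    by_cases hl : f.SameCycle b l
    · simp only [hl, if_true]; exact apply_eq_of_sameCycle hx hl
    · simp only [hl, if_false]
  · rintro ⟨y, c⟩ hy
    simp only [Finset.coe_product, Finset.coe_filter, Finset.mem_univ, true_and, Finset.coe_univ,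
      Set.mem_prod, Set.mem_ofPred_eq, Set.mem_univ, and_true] at hy
    refine Prod.ext ?_ (by simp only [SameCycle.refl, if_true])
    funext l
    by_cases hl : f.SameCycle b l
    · simp only [hl, if_true, hba, if_false]
      rw [hy.2]; exact apply_eq_of_sameCycle hy.1 hl
    · simp only [hl, if_false]

lemma card_invariant_mul_swap (f : Equiv.Perm ι) (a b : ι) (d : ℕ) :
    (Finset.univ.filter fun x : ι → Fin d =>
      (∀ l, x ((f * Equiv.swap a b) l) = x l) ∧ x a = x b).card =
    (Finset.univ.filter fun x : ι → Fin d => (∀ l, x (f l) = x l) ∧ x a = x b).card := by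
  congr 1
  ext x
  simp only [Finset.mem_filter, Finset.mem_univ, true_and]
  exact and_congr_left fun h => invariant_mul_swap_iff f h

lemma invariantCount_mul_swap_of_sameCycle {f : Equiv.Perm ι} {a b : ι} (hab : a ≠ b)
    (h : f.SameCycle a b) (d : ℕ) :
    invariantCount (f * Equiv.swap a b) d = invariantCount f d * d := by
  rw [invariantCount_of_not_sameCycle (not_sameCycle_mul_swap_of_sameCycle hab h),
    card_invariant_mul_swap, invariantCount_of_sameCycle h]

lemma invariantCount_mul_swap_of_not_sameCycle {f : Equiv.Perm ι} {a b : ι}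
    (h : ¬ f.SameCycle a b) (d : ℕ) :
    invariantCount (f * Equiv.swap a b) d * d = invariantCount f d := by
  rw [invariantCount_of_sameCycle (sameCycle_mul_swap_of_not_sameCycle h),
    card_invariant_mul_swap, invariantCount_of_not_sameCycle h]

lemma invariantCount_mul_swap_le (f : Equiv.Perm ι) {a b : ι} (hab : a ≠ b) {d : ℕ} (hd : 0 < d) :
    invariantCount (f * Equiv.swap a b) d ≤ invariantCount f d * d := by
  by_cases h : f.SameCycle a b
  · exact (invariantCount_mul_swap_of_sameCycle hab h d).le
  · rw [← invariantCount_mul_swap_of_not_sameCycle h, mul_assoc]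
    exact Nat.le_mul_of_pos_right _ (Nat.mul_pos hd hd)

end Cycles

/-! ### Genus bounds: multiplication by an involution -/

section Involutions

variable {ι : Type*} [Fintype ι] [DecidableEq ι]

lemma involution_apply_apply {σ : Equiv.Perm ι} (hσ : σ * σ = 1) (l : ι) : σ (σ l) = l := by
  rw [← Equiv.Perm.mul_apply, hσ, Equiv.Perm.one_apply]

lemma swap_mul_involution_apply_left {σ : Equiv.Perm ι} (a : ι) :
    (Equiv.swap a (σ a) * σ) a = a := by simp

lemma swap_mul_involution_apply_right {σ : Equiv.Perm ι} (hσ : σ * σ = 1) (a : ι) :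
    (Equiv.swap a (σ a) * σ) (σ a) = σ a := by
  simp [involution_apply_apply hσ]

lemma swap_mul_involution_apply_of_ne {σ : Equiv.Perm ι} (hσ : σ * σ = 1) {a l : ι} (h1 : l ≠ a)
    (h2 : l ≠ σ a) : (Equiv.swap a (σ a) * σ) l = σ l := by
  rw [Equiv.Perm.mul_apply, Equiv.swap_apply_of_ne_of_ne]
  · intro h; exact h2 (by rw [← h, involution_apply_apply hσ])
  · intro h; exact h1 (σ.injective h)

lemma swap_mul_involution_sq {σ : Equiv.Perm ι} (hσ : σ * σ = 1) (a : ι) :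
    (Equiv.swap a (σ a) * σ) * (Equiv.swap a (σ a) * σ) = 1 := by
  ext l
  rw [Equiv.Perm.mul_apply, Equiv.Perm.one_apply]
  by_cases h1 : l = a
  · subst h1; rw [swap_mul_involution_apply_left, swap_mul_involution_apply_left]
  by_cases h2 : l = σ a
  · subst h2; rw [swap_mul_involution_apply_right hσ, swap_mul_involution_apply_right hσ]
  rw [swap_mul_involution_apply_of_ne hσ h1 h2, swap_mul_involution_apply_of_ne hσ,
    involution_apply_apply hσ]
  · intro h; exact h2 (by rw [← h, involution_apply_apply hσ])
  · intro h; exact h1 (σ.injective h)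

lemma support_swap_mul_involution {σ : Equiv.Perm ι} (hσ : σ * σ = 1) (a : ι) :
    (Equiv.swap a (σ a) * σ).support = (σ.support.erase a).erase (σ a) := by
  ext l
  simp only [Equiv.Perm.mem_support, Finset.mem_erase]
  by_cases h1 : l = a
  · subst h1; rw [swap_mul_involution_apply_left]; simp
  by_cases h2 : l = σ a
  · subst h2; rw [swap_mul_involution_apply_right hσ]; simp
  rw [swap_mul_involution_apply_of_ne hσ h1 h2]
  tauto

lemma card_support_swap_mul_involution {σ : Equiv.Perm ι} (hσ : σ * σ = 1) {a : ι}
    (ha : σ a ≠ a) : (Equiv.swap a (σ a) * σ).support.card + 2 = σ.support.card := by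
  have h1 : a ∈ σ.support := Equiv.Perm.mem_support.2 ha
  have h2 : σ a ∈ σ.support.erase a :=
    Finset.mem_erase.2 ⟨ha, by simpa using ha⟩
  rw [support_swap_mul_involution hσ, Finset.card_erase_of_mem h2, Finset.card_erase_of_mem h1]
  have := Finset.card_pos.2 ⟨_, h2⟩
  rw [Finset.card_erase_of_mem h1] at this
  omega

lemma mul_involution_eq (f σ : Equiv.Perm ι) (a : ι) :
    f * σ = (f * Equiv.swap a (σ a)) * (Equiv.swap a (σ a) * σ) := by
  rw [mul_assoc, ← mul_assoc (Equiv.swap a (σ a)), Equiv.swap_mul_self, one_mul]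

/-- Peel off one pair at a time: each transposition costs at most a factor `d = r * r` and accounts
for two points of the support. -/
lemma invariantCount_mul_involution_le {d : ℕ} (hd : 0 < d) {r : ℝ} (hr0 : 0 ≤ r)
    (hr : r * r = d)    (f : Equiv.Perm ι) {σ : Equiv.Perm ι} (hσ : σ * σ = 1) :
    (invariantCount (f * σ) d : ℝ) ≤ invariantCount f d * r ^ σ.support.card := by
  induction hs : σ.support.card using Nat.strong_induction_on generalizing f σ with
  | _ s ih =>
    by_cases h1 : σ = 1
    · subst h1
      simp at hs
      simp [← hs]
    obtain ⟨a, ha⟩ : ∃ a, σ a ≠ a := by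
      by_contra! h; exact h1 (Equiv.ext h)
    have hc := card_support_swap_mul_involution hσ ha
    have h2 := ih _ (by omega) (f * Equiv.swap a (σ a)) (swap_mul_involution_sq hσ a) rfl
    rw [← mul_involution_eq] at h2
    refine h2.trans ?_
    rw [← hs, ← hc, pow_add, pow_two, hr, mul_comm (r ^ _), ← mul_assoc]
    refine mul_le_mul_of_nonneg_right ?_ (pow_nonneg hr0 _)
    exact_mod_cast invariantCount_mul_swap_le f ha.symm hd

/-- The pair at a is peeled off first. It merges two cycles, so `d * d` drops to `d`; this remaining
`d` supplies the two factors `r` of that pair, and the other pairs are bounded as before. -/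
lemma invariantCount_mul_involution_le_of_not_sameCycle {d : ℕ} (hd : 0 < d) {r : ℝ} (hr0 : 0 ≤ r)
    (hr : r * r = d) {f : Equiv.Perm ι} (hf : invariantCount f d = d * d) {σ : Equiv.Perm ι}
    (hσ : σ * σ = 1) {a : ι} (ha : ¬ f.SameCycle a (σ a)) :
    (invariantCount (f * σ) d : ℝ) ≤ r ^ σ.support.card := by
  have hne : σ a ≠ a := fun h => ha (by rw [h])
  have hc := card_support_swap_mul_involution hσ hne
  have h1 := invariantCount_mul_swap_of_not_sameCycle ha d
  rw [hf] at h1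
  have h2 := invariantCount_mul_involution_le hd hr0 hr (f * Equiv.swap a (σ a))
    (swap_mul_involution_sq hσ a)
  rw [← mul_involution_eq, Nat.eq_of_mul_eq_mul_right hd h1] at h2
  rwa [← hc, pow_add, pow_two, hr, mul_comm (r ^ _)]

end Involutions

/-! ### One circle: noncrossing and crossing involutions -/

section Rotation

lemma invariantCount_finRotate (k d : ℕ) : invariantCount (finRotate (k + 1)) d = d := by
  unfold invariantCount
  refine Eq.trans (congrArg Finset.card (?_ : _ = Finset.univ.image fun c : Fin d =>
    fun _ : Fin (k + 1) => c)) ?_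
  · ext x
    simp only [Finset.mem_filter, Finset.mem_univ, true_and, Finset.mem_image]
    constructor
    · intro h
      refine ⟨x 0, funext fun l => ?_⟩
      induction l using Fin.induction with
      | zero => rfl
      | succ l ih =>
        have := h l.castSucc
        rw [finRotate_apply, Fin.coeSucc_eq_succ] at this
        rw [ih, this]
    · rintro ⟨c, rfl⟩ l
      rfl
  · rw [Finset.card_image_of_injective _ fun c c' h => congrFun h 0, Finset.card_fin]

lemma invariantCount_inv {ι : Type*} [Fintype ι] [DecidableEq ι] (f : Equiv.Perm ι) (d : ℕ) :
    invariantCount f⁻¹ d = invariantCount f d := by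
  unfold invariantCount
  congr 1
  ext x
  simp only [Finset.mem_filter, Finset.mem_univ, true_and]
  constructor
  · intro h l
    have := h (f l)
    rw [Equiv.Perm.inv_def, Equiv.symm_apply_apply] at this
    exact this.symm
  · intro h l
    have := h (f⁻¹ l)
    rw [Equiv.Perm.inv_def, Equiv.apply_symm_apply] at this
    exact this.symm

lemma invariantCount_sumCongr {ι κ : Type*} [Fintype ι] [DecidableEq ι] [Fintype κ]
    [DecidableEq κ] (f : Equiv.Perm ι) (g : Equiv.Perm κ) (d : ℕ) :
    invariantCount (Equiv.Perm.sumCongr f g) d = invariantCount f d * invariantCount g d := by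
  unfold invariantCount
  rw [← Finset.card_product]
  refine Finset.card_nbij' (fun x => (fun l => x (Sum.inl l), fun l => x (Sum.inr l)))
    (fun y => Sum.elim y.1 y.2) ?_ ?_ ?_ ?_
  · intro x hx
    simpa using hx
  · intro y hy
    simpa using hy
  · intro x _
    funext l
    cases l <;> rfl
  · intro y _
    rfl

/-- `σ` has no two crossing pairs. -/
def IsNoncrossingInvolution {k : ℕ} (σ : Equiv.Perm (Fin k)) : Prop :=
  ∀ i p j q : Fin k, i < p → p < j → j < q → σ i = j → σ p = q → False

variable {k : ℕ}

lemma val_finRotate_of_lt {a b : Fin (k + 1)} (h : a < b) :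
    (finRotate (k + 1) a : ℕ) = a + 1 := by
  rw [finRotate_apply]
  exact Fin.val_add_one_of_lt (lt_of_lt_of_le h (Fin.le_last b))

lemma sameCycle_finRotate (a b : Fin (k + 1)) : (finRotate (k + 1)).SameCycle a b := by
  have h0 : ∀ l, (finRotate (k + 1)).SameCycle 0 l := by
    intro l
    induction l using Fin.induction with
    | zero => exact SameCycle.refl _ _
    | succ l ih => rwa [← Fin.coeSucc_eq_succ, ← finRotate_apply, sameCycle_apply_right]
  exact (h0 a).symm.trans (h0 b)

/-- The chord from i to j cuts the circle into two cycles, and the chord from p to q joins these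
two. The bound is a factor `d` below the noncrossing value `d * r ^ σ.support.card`. -/
lemma invariantCount_finRotate_mul_le_of_crossing {d : ℕ} (hd : 0 < d) {r : ℝ} (hr0 : 0 ≤ r)
    (hr : r * r = d) {σ : Equiv.Perm (Fin (k + 1))} (hσ : σ * σ = 1) {i p j q : Fin (k + 1)}
    (hip : i < p) (hpj : p < j) (hjq : j < q) (hij : σ i = j) (hpq : σ p = q) :
    (invariantCount (finRotate (k + 1) * σ) d : ℝ) ≤ r ^ σ.support.card := by
  have hi : σ i ≠ i := by rw [hij]; exact (hip.trans hpj).ne'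
  have hc := card_support_swap_mul_involution hσ hi
  have h1 := invariantCount_mul_swap_of_sameCycle hi.symm (sameCycle_finRotate i (σ i)) d
  rw [invariantCount_finRotate] at h1
  have hτ : (Equiv.swap i (σ i) * σ) p = q := by
    rw [swap_mul_involution_apply_of_ne hσ hip.ne' (by rw [hij]; exact hpj.ne), hpq]
  have h2 := invariantCount_mul_involution_le_of_not_sameCycle hd hr0 hr h1
    (swap_mul_involution_sq hσ i) (a := p) ?_
  · rw [← mul_involution_eq] at h2
    refine h2.trans ?_
    rw [← hc]
    -- A further factor `d` is given away here; losing one is enough for the limit.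
    refine pow_le_pow_right₀ ?_ (Nat.le_add_right _ _)
    have : (1 : ℝ) ≤ d := by exact_mod_cast hd
    nlinarith
  · rw [hτ, hij]
    -- After the cut, j goes to i + 1 and every other point of (i, j] to its successor. So (i, j] is
    -- invariant; it contains p but not q.
    refine not_sameCycle_of_invariant (T := {l | i < l ∧ l ≤ j}) ?_ ⟨hip, hpj.le⟩
      (fun h => absurd h.2 (not_le.2 hjq))
    rintro l ⟨h3, h4⟩
    rw [Equiv.Perm.mul_apply]
    rcases eq_or_lt_of_le h4 with rfl | h5
    · rw [Equiv.swap_apply_right]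
      have := val_finRotate_of_lt (hip.trans hpj)
      simp only [Set.mem_ofPred_eq, Fin.lt_def, Fin.le_def] at *
      omega
    · rw [Equiv.swap_apply_of_ne_of_ne h3.ne' h5.ne]
      have := val_finRotate_of_lt h5
      simp only [Set.mem_ofPred_eq, Fin.lt_def, Fin.le_def] at *
      omega

/-- The orbit of a starts at a + 1, and every step from inside (a, b) leads into (a, b]. If it never
met b it would stay strictly between a and b, and could not return to a. -/
lemma sameCycle_finRotate_mul {τ : Equiv.Perm (Fin (k + 1))} {a b : Fin (k + 1)} (hab : a < b)
    (ha : τ a = a) (hτ : ∀ l, a < l → l < b → a < τ l ∧ τ l < b) :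
    (finRotate (k + 1) * τ).SameCycle a b := by
  by_contra hg
  set f := finRotate (k + 1) * τ with hf
  have key : ∀ j : ℕ, a < (f ^ (j + 1)) a ∧ (f ^ (j + 1)) a < b := by
    intro j
    have hne : (f ^ (j + 1)) a ≠ b := fun h =>
      hg ⟨(j + 1 : ℕ), by rw [zpow_natCast]; exact h⟩
    revert hne
    induction j with
    | zero =>
      intro hne
      have h1 : (f ^ (0 + 1)) a = finRotate (k + 1) a := by
        rw [zero_add, pow_one, hf, Equiv.Perm.mul_apply, ha]
      have h2 := val_finRotate_of_lt hab
      rw [h1] at hne ⊢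
      simp only [Fin.lt_def, ne_eq, Fin.ext_iff] at *
      omega
    | succ j ih =>
      intro hne
      have hne' : (f ^ (j + 1)) a ≠ b := fun h =>
        hg ⟨(j + 1 : ℕ), by rw [zpow_natCast]; exact h⟩
      obtain ⟨h3, h4⟩ := hτ _ (ih hne').1 (ih hne').2
      have h1 : (f ^ (j + 1 + 1)) a = finRotate (k + 1) (τ ((f ^ (j + 1)) a)) := by
        rw [pow_succ', Equiv.Perm.mul_apply]
        rfl
      have h2 := val_finRotate_of_lt h4
      rw [h1] at hne ⊢
      simp only [Fin.lt_def, ne_eq, Fin.ext_iff] at *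
      omega
  have h0 := orderOf_pos f
  have h1 := (key (orderOf f - 1)).1
  rw [Nat.sub_add_cancel h0, pow_orderOf_eq_one, Equiv.Perm.one_apply] at h1
  exact lt_irrefl _ h1

/-- Induction on the number of pairs: with noncrossing chords, every added chord splits a cycle, so
each pair gains a full factor `d = r * r`. -/
lemma invariantCount_finRotate_mul_of_noncrossing (d : ℕ) {r : ℝ} (hr : r * r = d)
    {σ : Equiv.Perm (Fin (k + 1))} (hσ : σ * σ = 1) (hnc : IsNoncrossingInvolution σ) :
    (invariantCount (finRotate (k + 1) * σ) d : ℝ) = d * r ^ σ.support.card := by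
  induction hs : σ.support.card using Nat.strong_induction_on generalizing σ with
  | _ s ih =>
    by_cases h1 : σ = 1
    · subst h1
      simp at hs
      simp [← hs, invariantCount_finRotate]
    obtain ⟨a, ha⟩ : ∃ a, a < σ a := by
      by_contra! h
      refine h1 (Equiv.ext fun a => le_antisymm (h a) ?_)
      have := h (σ a)
      rwa [involution_apply_apply hσ] at this
    have hc := card_support_swap_mul_involution hσ ha.ne'
    have hsq := swap_mul_involution_sq hσ a
    have hτ : ∀ l, (Equiv.swap a (σ a) * σ) l = l ∨
        (l ≠ a ∧ l ≠ σ a ∧ (Equiv.swap a (σ a) * σ) l = σ l) := by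
      intro l
      by_cases h1 : l = a
      · subst h1; exact Or.inl (swap_mul_involution_apply_left _)
      by_cases h2 : l = σ a
      · subst h2; exact Or.inl (swap_mul_involution_apply_right hσ _)
      exact Or.inr ⟨h1, h2, swap_mul_involution_apply_of_ne hσ h1 h2⟩
    have hnc' : IsNoncrossingInvolution (Equiv.swap a (σ a) * σ) := by
      intro i p j q hip hpj hjq hij hpq
      rcases hτ i with h | ⟨-, -, h⟩
      · rw [h] at hij; exact (hip.trans hpj).ne hij
      rcases hτ p with h' | ⟨-, -, h'⟩
      · rw [h'] at hpq; exact (hpj.trans hjq).ne hpq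
      exact hnc i p j q hip hpj hjq (h ▸ hij) (h' ▸ hpq)
    have h2 := ih _ (by omega) hsq hnc' rfl
    -- A pair commutes with the rest of σ, so it can be multiplied on last, after the induction
    -- hypothesis has dealt with the other pairs.
    have hcomm : finRotate (k + 1) * σ =
        finRotate (k + 1) * (Equiv.swap a (σ a) * σ) * Equiv.swap a (σ a) := by
      rw [mul_assoc, mul_assoc]
      congr 1
      have h3 : Equiv.swap a (σ a) * σ = σ * Equiv.swap a (σ a) := by
        rw [Equiv.mul_swap_eq_swap_mul, involution_apply_apply hσ, Equiv.swap_comm]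
      rw [← mul_assoc, h3, mul_assoc, Equiv.swap_mul_self, mul_one]
    rw [hcomm, invariantCount_mul_swap_of_sameCycle ha.ne, Nat.cast_mul, h2, ← hs, ← hc, pow_add,
      pow_two r, hr, mul_assoc]
    -- A chord that starts strictly between a and `σ a` also ends there, since otherwise it would
    -- cross the chord at a.
    refine sameCycle_finRotate_mul ha (swap_mul_involution_apply_left _) ?_
    intro l hal hlb
    rw [swap_mul_involution_apply_of_ne hσ hal.ne' hlb.ne]
    constructor
    · refine lt_of_le_of_ne (not_lt.1 fun h => ?_) fun h => ?_
      · exact hnc _ a l (σ a) h hal hlb (involution_apply_apply hσ l) rfl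
      · rw [h, involution_apply_apply hσ] at hlb; exact lt_irrefl _ hlb
    · refine lt_of_le_of_ne (not_lt.1 fun h => ?_) fun h => ?_
      · exact hnc a l (σ a) (σ l) hal hlb h rfl rfl
      · exact hal.ne' (σ.injective h)

end Rotation

/-! ### Pairings and the combinatorial form of Wick's formula -/

section Pairings

variable {ι : Type*} [Fintype ι] [DecidableEq ι]

/-- The involutions of `ι` with support `S`, that is, the pairings of `S`. -/
def pairingsOn (S : Finset ι) : Finset (Equiv.Perm ι) :=
  Finset.univ.filter fun σ => σ * σ = 1 ∧ σ.support = S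

lemma mem_pairingsOn {S : Finset ι} {σ : Equiv.Perm ι} :
    σ ∈ pairingsOn S ↔ σ * σ = 1 ∧ σ.support = S := by
  simp [pairingsOn]

lemma swap_mul_apply_of_fixed {τ : Equiv.Perm ι} {a b l : ι} (ha : τ a = a) (hb : τ b = b)
    (hla : l ≠ a) (hlb : l ≠ b) : (Equiv.swap a b * τ) l = τ l := by
  rw [Equiv.Perm.mul_apply, Equiv.swap_apply_of_ne_of_ne]
  · intro h; exact hla (τ.injective (h.trans ha.symm))
  · intro h; exact hlb (τ.injective (h.trans hb.symm))

lemma swap_mul_mem_pairingsOn {S : Finset ι} {a b : ι} (ha : a ∉ S) (hb : b ∈ S)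
    {τ : Equiv.Perm ι} (hτ : τ ∈ pairingsOn (S.erase b)) :
    Equiv.swap a b * τ ∈ pairingsOn (insert a S) ∧ τ a = a ∧ τ b = b := by
  obtain ⟨h1, h2⟩ := mem_pairingsOn.1 hτ
  have hab : a ≠ b := fun h => ha (h ▸ hb)
  have ha' : τ a = a := by
    rw [← Equiv.Perm.notMem_support, h2]
    exact fun h => ha (Finset.mem_of_mem_erase h)
  have hb' : τ b = b := by
    rw [← Equiv.Perm.notMem_support, h2]
    exact Finset.notMem_erase b S
  refine ⟨mem_pairingsOn.2 ⟨?_, ?_⟩, ha', hb'⟩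
  · have hc : τ * Equiv.swap a b = Equiv.swap a b * τ := by
      rw [Equiv.mul_swap_eq_swap_mul, ha', hb']
    rw [mul_assoc, ← mul_assoc τ, hc, mul_assoc, h1, mul_one, Equiv.swap_mul_self]
  · ext l
    rw [Equiv.Perm.mem_support, Finset.mem_insert]
    by_cases hla : l = a
    · subst hla
      simp [ha', hab.symm]
    by_cases hlb : l = b
    · subst hlb
      simp [hb', hb, hab]
    rw [swap_mul_apply_of_fixed ha' hb' hla hlb, ← Equiv.Perm.mem_support, h2, Finset.mem_erase]
    tauto

/-- A pairing is determined by the partner b of a together with a pairing of the remaining points.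
-/
lemma sum_pairingsOn_insert {R : Type*} [AddCommMonoid R] {S : Finset ι} {a : ι} (ha : a ∉ S)
    (F : Equiv.Perm ι → R) :
    ∑ σ ∈ pairingsOn (insert a S), F σ =
      ∑ b ∈ S, ∑ τ ∈ pairingsOn (S.erase b), F (Equiv.swap a b * τ) := by
  rw [Finset.sum_sigma']
  refine Finset.sum_bij' (fun σ _ => ⟨σ a, Equiv.swap a (σ a) * σ⟩)
    (fun p _ => Equiv.swap a p.1 * p.2) ?_ ?_ ?_ ?_ ?_
  · intro σ hσ
    obtain ⟨h1, h2⟩ := mem_pairingsOn.1 hσ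
    have h3 : σ a ≠ a := by
      rw [← Equiv.Perm.mem_support, h2]; exact Finset.mem_insert_self a S
    have h4 : σ a ∈ S := by
      have : σ a ∈ σ.support := by simpa using h3
      rw [h2, Finset.mem_insert] at this
      exact this.resolve_left h3
    refine Finset.mem_sigma.2 ⟨h4, mem_pairingsOn.2 ⟨swap_mul_involution_sq h1 a, ?_⟩⟩
    rw [support_swap_mul_involution h1, h2, Finset.erase_insert ha]
  · rintro ⟨b, τ⟩ hp
    obtain ⟨hb, hτ⟩ := Finset.mem_sigma.1 hp
    exact (swap_mul_mem_pairingsOn ha hb hτ).1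
  · intro σ _
    simp
  · rintro ⟨b, τ⟩ hp
    obtain ⟨hb, hτ⟩ := Finset.mem_sigma.1 hp
    obtain ⟨-, h1, -⟩ := swap_mul_mem_pairingsOn ha hb hτ
    simp only at h1
    simp [h1]
  · intro σ _
    simp

/-- A functional on finite sets that satisfies the recursion of Wick's formula is a sum over
pairings. The covariances are given as products `c a b * c b a`. -/
theorem eq_sum_pairingsOn_of_recursion {R : Type*} [CommSemiring R] {E : Finset ι → R}
    {c : ι → ι → R} (h0 : E ∅ = 1)
    (hE : ∀ a S, a ∉ S → E (insert a S) = ∑ b ∈ S, c a b * c b a * E (S.erase b))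
    (S : Finset ι) : E S = ∑ σ ∈ pairingsOn S, ∏ l ∈ S, c l (σ l) := by
  induction hs : S.card using Nat.strong_induction_on generalizing S with
  | _ s ih =>
    rcases S.eq_empty_or_nonempty with rfl | ⟨a, haS⟩
    · have : pairingsOn (∅ : Finset ι) = {1} := by
        ext σ
        rw [mem_pairingsOn, Finset.mem_singleton, Equiv.Perm.support_eq_empty_iff]
        exact ⟨fun h => h.2, fun h => ⟨by rw [h, one_mul], h⟩⟩
      simp [this, h0]
    · obtain ⟨T, ha, rfl⟩ : ∃ T, a ∉ T ∧ insert a T = S :=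
        ⟨S.erase a, Finset.notMem_erase a S, Finset.insert_erase haS⟩
      rw [hE a T ha, sum_pairingsOn_insert ha]
      refine Finset.sum_congr rfl fun b hb => ?_
      have hc : (T.erase b).card < s := by
        rw [← hs, Finset.card_insert_of_notMem ha]
        exact (Finset.card_erase_lt_of_mem hb).trans (Nat.lt_succ_self _)
      rw [ih _ hc _ rfl, Finset.mul_sum]
      refine Finset.sum_congr rfl fun τ hτ => ?_
      obtain ⟨-, h1, h2⟩ := swap_mul_mem_pairingsOn ha hb hτ
      rw [Finset.prod_insert ha, ← Finset.mul_prod_erase T _ hb, mul_assoc]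
      congr 1
      · simp [h1]
      congr 1
      · simp [h2]
      refine Finset.prod_congr rfl fun l hl => ?_
      rw [swap_mul_apply_of_fixed h1 h2 (fun h => ha (h ▸ Finset.mem_of_mem_erase hl))
        (Finset.ne_of_mem_erase hl)]

end Pairings

/-! ### Moments of one Gaussian variable -/

section GaussianMoments

lemma integrable_pow_gaussianReal (v : ℝ≥0) (n : ℕ) : Integrable (fun x => x ^ n) (gaussianReal 0 v) := by
  rcases Nat.eq_zero_or_pos n with rfl | hn
  · simp
  have := (memLp_id_gaussianReal (μ := 0) (v := v) n).integrable_norm_pow hn.ne'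
  refine (integrable_norm_iff (by fun_prop)).1 ?_
  simpa using this

lemma hasDerivAt_gaussianPDFReal (v : ℝ≥0) (hv : v ≠ 0) (x : ℝ) :
    HasDerivAt (gaussianPDFReal 0 v) (-(x / v) * gaussianPDFReal 0 v x) x := by
  have hv' : (v : ℝ) ≠ 0 := by exact_mod_cast hv
  unfold gaussianPDFReal
  have h : HasDerivAt (fun x : ℝ => -(x - 0) ^ 2 / (2 * v)) (-(x / v)) x := by
    have := (((hasDerivAt_id x).sub_const 0).pow 2).neg.div_const (2 * (v : ℝ))
    refine this.congr_deriv ?_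
    simp
    field_simp
  refine (h.exp.const_mul (√(2 * Real.pi * v))⁻¹).congr_deriv ?_
  ring

lemma integrable_pow_mul_gaussianPDFReal (v : ℝ≥0) (hv : v ≠ 0) (n : ℕ) :
    Integrable (fun x => x ^ n * gaussianPDFReal 0 v x) := by
  have h := integrable_pow_gaussianReal v n
  rw [gaussianReal_of_var_ne_zero _ hv, integrable_withDensity_iff (measurable_gaussianPDF 0 v)
    (ae_of_all _ fun x => gaussianPDF_lt_top)] at h
  simpa only [toReal_gaussianPDF] using h

/-- Integration by parts against the density, whose derivative is -x / v times itself. For n = 0 the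
truncated exponent `n - 1` is harmless because of the factor n. -/
lemma integral_pow_succ_gaussianReal (v : ℝ≥0) (n : ℕ) :
    ∫ x, x ^ (n + 1) ∂(gaussianReal 0 v) = v * (n * ∫ x, x ^ (n - 1) ∂(gaussianReal 0 v)) := by
  rcases eq_or_ne v 0 with rfl | hv
  · simp [gaussianReal_zero_var]
  have hv' : (v : ℝ) ≠ 0 := by exact_mod_cast hv
  rw [integral_gaussianReal_eq_integral_smul hv, integral_gaussianReal_eq_integral_smul hv]
  simp only [smul_eq_mul]
  have h := integral_mul_deriv_eq_deriv_mul_of_integrable (u := fun x : ℝ => x ^ n)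
    (u' := fun x => n * x ^ (n - 1)) (v := gaussianPDFReal 0 v)
    (v' := fun x => -(x / v) * gaussianPDFReal 0 v x) (fun x _ => hasDerivAt_pow n x)
    (fun x _ => hasDerivAt_gaussianPDFReal v hv x) ?_ ?_ (integrable_pow_mul_gaussianPDFReal v hv n)
  · have h1 : ∀ x : ℝ, gaussianPDFReal 0 v x * x ^ (n + 1) =
        -v * (x ^ n * (-(x / v) * gaussianPDFReal 0 v x)) := fun x => by
      rw [pow_succ]
      field_simp
    have h2 : ∀ x : ℝ, n * x ^ (n - 1) * gaussianPDFReal 0 v x =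
        n * (gaussianPDFReal 0 v x * x ^ (n - 1)) := fun x => by ring
    simp only [h1, integral_const_mul]
    rw [h]
    simp only [h2, integral_const_mul]
    ring
  · refine ((integrable_pow_mul_gaussianPDFReal v hv (n + 1)).const_mul (-(v : ℝ)⁻¹)).congr
      (ae_of_all _ fun x => ?_)
    simp only [Pi.mul_apply, pow_succ]
    field_simp
  · refine ((integrable_pow_mul_gaussianPDFReal v hv (n - 1)).const_mul n).congr
      (ae_of_all _ fun x => ?_)
    simp only [Pi.mul_apply]
    ring

end GaussianMoments

/-! ### Gaussian integration by parts and Wick's recursion -/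

section GaussianPolynomials

variable {Ω X : Type*} [MeasurableSpace Ω] {P : Measure Ω} [IsProbabilityMeasure P] [Fintype X]
  {ξ : X → Ω → ℝ} {v : X → ℝ≥0}

lemma memLp_eval_of_gaussian (hlaw : ∀ x, HasLaw (ξ x) (gaussianReal 0 (v x)) P)
    (p : MvPolynomial X ℂ) (q : ENNReal) (hq : q ≠ ⊤) :
    MemLp (fun ω => MvPolynomial.eval (fun x => (ξ x ω : ℂ)) p) q P := by
  induction p using MvPolynomial.induction_on generalizing q with
  | C a => simpa using memLp_const a
  | add p₁ p₂ h₁ h₂ =>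
    simp only [map_add]
    exact (h₁ q hq).add (h₂ q hq)
  | mul_X p x h =>
    -- Hölder's inequality with exponents 2q and 2q; for this reason the induction runs over all
    -- finite exponents simultaneously.
    have hq2 : 2 * q ≠ ⊤ := ENNReal.mul_ne_top (by simp) hq
    have hX : MemLp (fun ω => (ξ x ω : ℂ)) (2 * q) P := by
      have h1 := memLp_id_gaussianReal' (μ := 0) (v := v x) (2 * q) hq2
      rw [← (hlaw x).map_eq] at h1
      have h2 := h1.comp_of_map (hlaw x).aemeasurable
      exact h2.ofReal
    have : ENNReal.HolderTriple (2 * q) (2 * q) q := ⟨by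
      rw [ENNReal.mul_inv (by simp) (by simp), ← two_mul, ← mul_assoc,
        ENNReal.mul_inv_cancel (by simp) (by simp), one_mul]⟩
    simp only [map_mul, MvPolynomial.eval_X]
    exact MemLp.mul' hX (h _ hq2)

lemma integrable_eval_of_gaussian (hlaw : ∀ x, HasLaw (ξ x) (gaussianReal 0 (v x)) P)
    (p : MvPolynomial X ℂ) :
    Integrable (fun ω => MvPolynomial.eval (fun x => (ξ x ω : ℂ)) p) P :=
  memLp_one_iff_integrable.1 (memLp_eval_of_gaussian hlaw p 1 (by simp))

lemma integral_eval_monomial_of_gaussian (hind : iIndepFun ξ P)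
    (hlaw : ∀ x, HasLaw (ξ x) (gaussianReal 0 (v x)) P) (s : X →₀ ℕ) (c : ℂ) :
    ∫ ω, MvPolynomial.eval (fun x => (ξ x ω : ℂ)) (MvPolynomial.monomial s c) ∂P =
      c * ∏ x, ((∫ t, t ^ s x ∂(gaussianReal 0 (v x)) : ℝ) : ℂ) := by
  have h1 : ∀ ω, MvPolynomial.eval (fun x => (ξ x ω : ℂ)) (MvPolynomial.monomial s c) =
      c * ((∏ x, ξ x ω ^ s x : ℝ) : ℂ) := by
    intro ω
    rw [MvPolynomial.eval_monomial, Finsupp.prod_fintype _ _ (fun i => pow_zero _)]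
    push_cast
    rfl
  simp only [h1]
  rw [integral_const_mul, integral_complex_ofReal, hind.integral_fun_prod_comp (f := fun x t => t ^ s x)
    (fun x => (hlaw x).aemeasurable) (fun x => by fun_prop)]
  push_cast
  congr 1
  refine Finset.prod_congr rfl fun x _ => ?_
  rw [← (hlaw x).map_eq, integral_map (hlaw x).aemeasurable (by fun_prop)]

/-- Gaussian integration by parts for polynomials in independent centred Gaussian variables. -/
theorem integral_mul_eval_of_gaussian (hind : iIndepFun ξ P)
    (hlaw : ∀ x, HasLaw (ξ x) (gaussianReal 0 (v x)) P) (x : X) (p : MvPolynomial X ℂ) :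
    ∫ ω, MvPolynomial.eval (fun y => (ξ y ω : ℂ)) (MvPolynomial.X x * p) ∂P =
      v x * ∫ ω, MvPolynomial.eval (fun y => (ξ y ω : ℂ)) (MvPolynomial.pderiv x p) ∂P := by
  classical
  induction p using MvPolynomial.induction_on' with
  | add p₁ p₂ h₁ h₂ =>
    simp only [mul_add, map_add] at *
    rw [integral_add, integral_add, h₁, h₂, mul_add]
    · exact integrable_eval_of_gaussian hlaw _
    · exact integrable_eval_of_gaussian hlaw _
    · exact integrable_eval_of_gaussian hlaw (MvPolynomial.X x * p₁)
    · exact integrable_eval_of_gaussian hlaw (MvPolynomial.X x * p₂)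
  | monomial s c =>
    have h1 : MvPolynomial.X x * MvPolynomial.monomial s c =
        MvPolynomial.monomial (Finsupp.single x 1 + s) c := by
      rw [MvPolynomial.X, MvPolynomial.monomial_mul, one_mul]
    rw [h1, MvPolynomial.pderiv_monomial, integral_eval_monomial_of_gaussian hind hlaw,
      integral_eval_monomial_of_gaussian hind hlaw, ← Finset.mul_prod_erase _ _ (Finset.mem_univ x),
      ← Finset.mul_prod_erase _ _ (Finset.mem_univ x)]
    -- By independence the integral of a monomial factors; only the factor of x changes, and there
    -- the one-variable recursion applies.
    have h2 : ∏ y ∈ Finset.univ.erase x,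
        ((∫ t, t ^ (Finsupp.single x 1 + s : X →₀ ℕ) y ∂(gaussianReal 0 (v y)) : ℝ) : ℂ) =
        ∏ y ∈ Finset.univ.erase x,
        ((∫ t, t ^ (s - Finsupp.single x 1 : X →₀ ℕ) y ∂(gaussianReal 0 (v y)) : ℝ) : ℂ) := by
      refine Finset.prod_congr rfl fun y hy => ?_
      have hne : x ≠ y := (Finset.ne_of_mem_erase hy).symm
      simp [hne]
    rw [h2]
    have h3 := integral_pow_succ_gaussianReal (v x) (s x)
    have h4 : (Finsupp.single x 1 + s : X →₀ ℕ) x = s x + 1 := by simp [add_comm]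
    have h5 : (s - Finsupp.single x 1 : X →₀ ℕ) x = s x - 1 := by simp
    rw [h4, h5, h3]
    push_cast
    ring

lemma pderiv_finset_prod {ι : Type*} [DecidableEq ι] (x : X) (Y : ι → MvPolynomial X ℂ)
    (S : Finset ι) : MvPolynomial.pderiv x (∏ b ∈ S, Y b) =
      ∑ b ∈ S, MvPolynomial.pderiv x (Y b) * ∏ l ∈ S.erase b, Y l := by
  induction S using Finset.induction_on with
  | empty => simp
  | insert a S ha ih =>
    rw [Finset.prod_insert ha, MvPolynomial.pderiv_mul, ih, Finset.sum_insert ha,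
      Finset.erase_insert ha, Finset.mul_sum]
    congr 1
    refine Finset.sum_congr rfl fun b hb => ?_
    have hab : a ≠ b := fun h => ha (h ▸ hb)
    rw [Finset.erase_insert_of_ne hab, Finset.prod_insert (fun h => ha (Finset.mem_of_mem_erase h))]
    ring

variable {ι : Type*} [DecidableEq ι] {c : ι → X → ℂ} {Z : ι → Ω → ℂ}

/-- The polynomial `∑ x, c x * X x`. -/
noncomputable def linearForm (c : X → ℂ) : MvPolynomial X ℂ :=
  ∑ x, MvPolynomial.C (c x) * MvPolynomial.X x

lemma pderiv_linearForm (c : X → ℂ) (x : X) :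
    MvPolynomial.pderiv x (linearForm c) = MvPolynomial.C (c x) := by
  classical
  simp only [linearForm, map_sum, MvPolynomial.pderiv_C_mul, MvPolynomial.pderiv_X]
  rw [Finset.sum_eq_single x]
  · simp
  · intro y _ hy
    simp [hy]
  · simp

lemma prod_eq_eval_linearForm (hZ : ∀ l ω, Z l ω = ∑ x, c l x * ξ x ω) (S : Finset ι) (ω : Ω) :
    ∏ l ∈ S, Z l ω =
      MvPolynomial.eval (fun x => (ξ x ω : ℂ)) (∏ l ∈ S, linearForm (c l)) := by
  simp [map_prod, linearForm, hZ]

lemma memLp_prod_of_gaussian (hlaw : ∀ x, HasLaw (ξ x) (gaussianReal 0 (v x)) P)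
    (hZ : ∀ l ω, Z l ω = ∑ x, c l x * ξ x ω) (S : Finset ι) (q : ENNReal) (hq : q ≠ ⊤) :
    MemLp (fun ω => ∏ l ∈ S, Z l ω) q P := by
  simp only [prod_eq_eval_linearForm hZ]
  exact memLp_eval_of_gaussian hlaw _ q hq

/-- The recursion of Wick's formula for linear combinations of independent centred Gaussian
variables. -/
theorem integral_prod_insert_of_gaussian (hind : iIndepFun ξ P)
    (hlaw : ∀ x, HasLaw (ξ x) (gaussianReal 0 (v x)) P)
    (hZ : ∀ l ω, Z l ω = ∑ x, c l x * ξ x ω) {a : ι} {S : Finset ι} (ha : a ∉ S) :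
    ∫ ω, ∏ l ∈ insert a S, Z l ω ∂P =
      ∑ b ∈ S, (∑ x, v x * c a x * c b x) * ∫ ω, ∏ l ∈ S.erase b, Z l ω ∂P := by
  simp only [prod_eq_eval_linearForm hZ]
  rw [Finset.prod_insert ha]
  nth_rewrite 1 [linearForm]
  simp only [Finset.sum_mul, map_sum]
  rw [integral_finsetSum]
  swap
  · exact fun x _ => integrable_eval_of_gaussian hlaw _
  simp only [mul_assoc]
  have h1 : ∀ x (p : MvPolynomial X ℂ),
      ∫ ω, MvPolynomial.eval (fun y => (ξ y ω : ℂ)) (MvPolynomial.C (c a x) * p) ∂P =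
      c a x * ∫ ω, MvPolynomial.eval (fun y => (ξ y ω : ℂ)) p ∂P := by
    intro x p
    simp only [map_mul, MvPolynomial.eval_C, integral_const_mul]
  simp only [h1, integral_mul_eval_of_gaussian hind hlaw, pderiv_finset_prod, map_sum,
    pderiv_linearForm]
  rw [Finset.sum_comm]
  refine Finset.sum_congr rfl fun x _ => ?_
  rw [integral_finsetSum]
  swap
  · exact fun b _ => integrable_eval_of_gaussian hlaw _
  simp only [map_mul, MvPolynomial.eval_C, integral_const_mul, Finset.mul_sum]
  refine Finset.sum_congr rfl fun b _ => ?_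
  ring

end GaussianPolynomials

/-! ### Real coordinates and covariances of a GUE matrix -/

section GUE

variable {N : Type*} [Fintype N] [LinearOrder N]

/-- The index set of the independent real coordinates of a Hermitian matrix. -/
abbrev HermitianIndex (N : Type*) [LinearOrder N] : Type _ :=
  {p : N × N // p.2 ≤ p.1} ⊕ {p : N × N // p.2 < p.1}

/-- The independent real coordinates of a Hermitian matrix. -/
def hermitianCoord (A : Matrix N N ℂ) : HermitianIndex N → ℝ :=
  Sum.elim (fun p => (A p.1.1 p.1.2).re) (fun p => (A p.1.1 p.1.2).im)

/-- The variances of the real coordinates of a GUE matrix. -/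
noncomputable def gueVar : HermitianIndex N → ℝ≥0 :=
  Sum.elim (fun p => if p.1.2 = p.1.1 then 1 / (Fintype.card N : ℝ≥0)
    else 1 / (2 * (Fintype.card N : ℝ≥0))) (fun _ => 1 / (2 * (Fintype.card N : ℝ≥0)))

/-- The coefficients of the entry at `i, j` of a Hermitian matrix in its real coordinates. -/
noncomputable def hermitianCoeff (i j : N) : HermitianIndex N → ℂ :=
  Sum.elim (fun p => if p.1 = (max i j, min i j) then 1 else 0)
    (fun p => if p.1 = (max i j, min i j) then (if j < i then Complex.I else -Complex.I) else 0)

lemma sum_lowerTriangle (i j : N) (f : N × N → ℂ) :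
    ∑ p : {p : N × N // p.2 ≤ p.1}, (if p.1 = (max i j, min i j) then f p.1 else 0) =
      f (max i j, min i j) := by
  have h : min i j ≤ max i j := min_le_max
  rw [Finset.sum_eq_single ⟨(max i j, min i j), h⟩]
  · simp
  · intro p _ hp
    rw [if_neg]
    exact fun h' => hp (Subtype.ext h')
  · simp

lemma sum_strictLowerTriangle (i j : N) (f : N × N → ℂ) :
    ∑ p : {p : N × N // p.2 < p.1}, (if p.1 = (max i j, min i j) then f p.1 else 0) =
      if i = j then 0 else f (max i j, min i j) := by
  by_cases hij : i = j
  · subst hij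
    rw [if_pos rfl]
    refine Finset.sum_eq_zero fun p _ => if_neg fun h => ?_
    have := p.2
    simp [h] at this
  · rw [if_neg hij]
    have h : min i j < max i j := min_lt_max.2 hij
    rw [Finset.sum_eq_single ⟨(max i j, min i j), h⟩]
    · simp
    · intro p _ hp
      rw [if_neg]
      exact fun h' => hp (Subtype.ext h')
    · simp

lemma entry_eq_sum_hermitianCoeff {A : Matrix N N ℂ} (hA : A.IsHermitian) (i j : N) :
    A i j = ∑ x, hermitianCoeff i j x * hermitianCoord A x := by
  rw [Fintype.sum_sum_type]
  simp only [hermitianCoeff, hermitianCoord, Sum.elim_inl, Sum.elim_inr, ite_mul, zero_mul, one_mul]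
  rw [sum_lowerTriangle i j fun p => ((A p.1 p.2).re : ℂ),
    sum_strictLowerTriangle i j fun p =>
      (if j < i then Complex.I * ((A p.1 p.2).im : ℂ) else -Complex.I * ((A p.1 p.2).im : ℂ))]
  have hA' := hA.apply i j
  rcases lt_trichotomy i j with h | rfl | h
  · rw [if_neg h.ne, if_neg h.not_gt, max_eq_right h.le, min_eq_left h.le, ← hA']
    apply Complex.ext <;> simp
  · rw [if_pos rfl, max_self, min_self]
    rw [Complex.star_def, Complex.conj_eq_iff_real] at hA'
    obtain ⟨r, hr⟩ := hA'
    simp [hr]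
  · rw [if_neg h.ne', if_pos h, max_eq_left h.le, min_eq_right h.le]
    apply Complex.ext <;> simp

/-- Off the diagonal, the real and imaginary parts contribute half of 1 / card N each. The two
halves add up for transposed positions and cancel for equal ones, where I * I = -1. -/
lemma sum_gueVar_mul_hermitianCoeff (i j k l : N) :
    ∑ x, (gueVar x : ℂ) * hermitianCoeff i j x * hermitianCoeff k l x =
      if i = l ∧ j = k then (Fintype.card N : ℂ)⁻¹ else 0 := by
  rw [Fintype.sum_sum_type]
  set D : ℂ := (Fintype.card N : ℂ)⁻¹ with hD
  have h1 : ∀ p : {p : N × N // p.2 ≤ p.1}, (gueVar (Sum.inl p) : ℂ) * hermitianCoeff i j (Sum.inl p) *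
      hermitianCoeff k l (Sum.inl p) = if p.1 = (max i j, min i j) then
        (if p.1.2 = p.1.1 then D else D / 2) * (if p.1 = (max k l, min k l) then 1 else 0)
        else 0 := by
    intro p
    simp only [hermitianCoeff, gueVar, Sum.elim_inl, mul_ite, mul_one, mul_zero]
    split_ifs <;> simp [hD, mul_comm, div_eq_mul_inv]
  have h2 : ∀ p : {p : N × N // p.2 < p.1}, (gueVar (Sum.inr p) : ℂ) * hermitianCoeff i j (Sum.inr p) *
      hermitianCoeff k l (Sum.inr p) = if p.1 = (max i j, min i j) then
        (D / 2) * (if j < i then Complex.I else -Complex.I) * (if p.1 = (max k l, min k l) then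
          (if l < k then Complex.I else -Complex.I) else 0) else 0 := by
    intro p
    simp only [hermitianCoeff, gueVar, Sum.elim_inr, mul_ite, mul_zero, ite_mul, zero_mul]
    split_ifs <;> simp [hD, mul_comm, div_eq_mul_inv]
  simp only [h1, h2]
  rw [sum_lowerTriangle i j fun p =>
      (if p.2 = p.1 then D else D / 2) * (if p = (max k l, min k l) then 1 else 0),
    sum_strictLowerTriangle i j fun p =>
      (D / 2) * (if j < i then Complex.I else -Complex.I) * (if p = (max k l, min k l) then
          (if l < k then Complex.I else -Complex.I) else 0)]
  have hI : D / 2 * Complex.I * Complex.I = -(D / 2) := by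
    rw [mul_assoc, Complex.I_mul_I]; ring
  simp only [Prod.mk.injEq]
  rcases lt_trichotomy i j with h | rfl | h <;> rcases lt_trichotomy k l with h' | rfl | h'
  · rw [max_eq_right h.le, min_eq_left h.le, max_eq_right h'.le, min_eq_left h'.le]
    have : ¬ (i = l ∧ j = k) := by rintro ⟨rfl, rfl⟩; exact lt_asymm h h'
    simp only [h.ne, h.not_gt, h'.not_gt, this, if_false]
    split_ifs <;> simp [hI]
  · rw [max_eq_right h.le, min_eq_left h.le, max_self, min_self]
    have h1 : ¬ (i = k ∧ j = k) := by rintro ⟨rfl, rfl⟩; exact lt_irrefl _ h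
    simp [h1, and_comm (a := j = k)]
  · rw [max_eq_right h.le, min_eq_left h.le, max_eq_left h'.le, min_eq_right h'.le]
    simp only [h.ne, h.not_gt, h', if_false, if_true, and_comm (a := j = k)]
    split_ifs <;> simp [hI]
  · rw [max_self, min_self, max_eq_right h'.le, min_eq_left h'.le]
    have h1 : ¬ (i = l ∧ i = k) := by rintro ⟨rfl, rfl⟩; exact lt_irrefl _ h'
    simp [h1]
  · simp
  · rw [max_self, min_self, max_eq_left h'.le, min_eq_right h'.le]
    have h1 : ¬ (i = k ∧ i = l) := by rintro ⟨rfl, rfl⟩; exact lt_irrefl _ h'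
    have h2 : ¬ (i = l ∧ i = k) := by rintro ⟨rfl, rfl⟩; exact lt_irrefl _ h'
    simp [h1, h2]
  · rw [max_eq_left h.le, min_eq_right h.le, max_eq_right h'.le, min_eq_left h'.le]
    simp only [h.ne, h.ne', h, h'.not_gt, if_false, if_true]
    split_ifs <;> simp [hI]
  · rw [max_eq_left h.le, min_eq_right h.le, max_self, min_self]
    have h1 : ¬ (i = k ∧ j = k) := by rintro ⟨rfl, rfl⟩; exact lt_irrefl _ h
    simp [h1]
  · rw [max_eq_left h.le, min_eq_right h.le, max_eq_left h'.le, min_eq_right h'.le]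
    have : ¬ (i = l ∧ j = k) := by rintro ⟨rfl, rfl⟩; exact lt_asymm h h'
    simp only [h.ne, h.ne', h, h', this, if_false, if_true]
    split_ifs <;> simp [hI]

variable {Ω : Type*} [MeasurableSpace Ω] {P : Measure Ω} {A : Ω → Matrix N N ℂ}

lemma IsGUE.hasLaw_hermitianCoord (hA : IsGUE A P) (x : HermitianIndex N) :
    HasLaw (fun ω => hermitianCoord (A ω) x) (gaussianReal 0 (gueVar x)) P := by
  rcases x with ⟨⟨i, j⟩, h⟩ | ⟨⟨i, j⟩, h⟩
  · rcases eq_or_lt_of_le h with h' | h'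
    · have h'' : j = i := h'
      subst h''
      simpa [hermitianCoord, gueVar] using hA.law_diag j
    · have h'' : j < i := h'
      simpa [hermitianCoord, gueVar, h''.ne] using hA.law_re i j h''
  · simpa [hermitianCoord, gueVar] using hA.law_im i j h

lemma IsGUE.measurable_hermitianCoord (hA : IsGUE A P) (x : HermitianIndex N) :
    Measurable fun ω => hermitianCoord (A ω) x := by
  rcases x with p | p
  · exact Complex.measurable_re.comp (hA.measurable _ _)
  · exact Complex.measurable_im.comp (hA.measurable _ _)

end GUE

/-! ### Covariances of the local terms, site by site -/

section LocalTerms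

variable {Ω : Type*} [MeasurableSpace Ω] {P : Measure Ω} [IsProbabilityMeasure P]
  {n m d : ℕ} {K : Fin m → Finset (Fin n)}
  {G : (a : Fin m) → Ω → Matrix (SiteIndex (K a) d) (SiteIndex (K a) d) ℂ}

/-- Independence of the matrices and independence within each matrix combine into one independent
family, as Wick's recursion requires. -/
lemma iIndepFun_hermitianCoord (hGUE : ∀ a, IsGUE (G a) P)
    (hIndep : iIndepFun (fun (a : Fin m) (ω : Ω) (p : SiteIndex (K a) d × SiteIndex (K a) d) =>
      G a ω p.1 p.2) P) :
    iIndepFun (fun (z : (a : Fin m) × HermitianIndex (SiteIndex (K a) d)) (ω : Ω) =>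
      hermitianCoord (G z.1 ω) z.2) P := by
  refine iIndepFun_uncurry (X := fun a x ω => hermitianCoord (G a ω) x)
    (fun a x => (hGUE a).measurable_hermitianCoord x) ?_ fun a => (hGUE a).indep
  refine hIndep.comp (fun a (f : SiteIndex (K a) d × SiteIndex (K a) d → ℂ) =>
    (Sum.elim (fun p => (f p.1).re) (fun p => (f p.1).im) :
      HermitianIndex (SiteIndex (K a) d) → ℝ)) fun a => ?_
  refine measurable_pi_lambda _ fun x => ?_
  rcases x with p | p
  · exact Complex.measurable_re.comp (measurable_pi_apply _)
  · exact Complex.measurable_im.comp (measurable_pi_apply _)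

/-- The coefficients of the entry at `i, j` of `localTerm (K a) (G a ω)` in the real coordinates of
the family `G`. -/
noncomputable def localCoeff (K : Fin m → Finset (Fin n)) (a : Fin m) (i j : Fin n → Fin d)
    (z : (a : Fin m) × HermitianIndex (SiteIndex (K a) d)) : ℂ :=
  if a = z.1 then (∏ s ∈ (K z.1)ᶜ, if i s = j s then 1 else 0) *
    hermitianCoeff (toLex fun s : K z.1 => i s) (toLex fun s : K z.1 => j s) z.2 else 0

lemma localTerm_eq_sum (hG : ∀ a ω, (G a ω).IsHermitian) (a : Fin m) (ω : Ω)
    (i j : Fin n → Fin d) :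
    localTerm (K a) (G a ω) i j =
      ∑ z : (a : Fin m) × HermitianIndex (SiteIndex (K a) d),
        localCoeff K a i j z * hermitianCoord (G z.1 ω) z.2 := by
  rw [Fintype.sum_sigma, Finset.sum_eq_single a]
  · simp only [localCoeff, if_true, mul_assoc, ← Finset.mul_sum]
    have h := entry_eq_sum_hermitianCoeff (hG a ω) (toLex fun s : K a => i s)
      (toLex fun s : K a => j s)
    simp only [localTerm, Matrix.of_apply]
    rw [mul_comm]
    congr 1
  · intro b _ hb
    simp [localCoeff, hb.symm]
  · simp

lemma ite_mul_ite_mul_ite {p q u t : Prop} {_ : Decidable p} {_ : Decidable q} {_ : Decidable u}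
    {_ : Decidable t} (h : u ∧ p ∧ q ↔ t) (c : ℂ) :
    (if p then 1 else 0) * (if q then 1 else 0) * (if u then c else 0) = if t then c else 0 := by
  by_cases p <;> by_cases q <;> by_cases u <;> simp [*, ← h]

lemma sum_localCoeff_mul (a b : Fin m) (i j i' j' : Fin n → Fin d) :
    ∑ z : (a : Fin m) × HermitianIndex (SiteIndex (K a) d),
      (gueVar z.2 : ℂ) * localCoeff K a i j z * localCoeff K b i' j' z =
    if a = b ∧ (∀ s ∈ K a, i s = j' s ∧ j s = i' s) ∧ (∀ s ∉ K a, i s = j s ∧ i' s = j' s)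
      then ((d : ℂ) ^ (K a).card)⁻¹ else 0 := by
  rw [Fintype.sum_sigma, Finset.sum_eq_single a]
  · by_cases hab : a = b
    · subst hab
      have h1 : ∀ x : HermitianIndex (SiteIndex (K a) d),
          (gueVar x : ℂ) * localCoeff K a i j ⟨a, x⟩ * localCoeff K a i' j' ⟨a, x⟩ =
          (if ∀ s ∈ (K a)ᶜ, i s = j s then 1 else 0) * (if ∀ s ∈ (K a)ᶜ, i' s = j' s then 1 else 0) *
          ((gueVar x : ℂ) * hermitianCoeff (toLex fun s : K a => i s) (toLex fun s : K a => j s) x *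
            hermitianCoeff (toLex fun s : K a => i' s) (toLex fun s : K a => j' s) x) := by
        intro x
        simp only [localCoeff, if_true, Finset.prod_ite_zero, Finset.prod_const_one]
        ring
      simp only [h1]
      rw [← Finset.mul_sum, sum_gueVar_mul_hermitianCoeff]
      have hD : (Fintype.card (SiteIndex (K a) d) : ℂ) = (d : ℂ) ^ (K a).card := by
        have : Fintype.card (SiteIndex (K a) d) = d ^ (K a).card := by
          change Fintype.card (K a → Fin d) = _
          simp
        rw [this]
        push_cast
        rfl
      rw [hD]
      have h2 : ∀ x y : Fin n → Fin d, (toLex fun s : K a => x s) = (toLex fun s : K a => y s) ↔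
          ∀ s ∈ K a, x s = y s := by
        intro x y
        rw [toLex_inj, funext_iff]
        exact ⟨fun h s hs => h ⟨s, hs⟩, fun h s => h s s.2⟩
      refine ite_mul_ite_mul_ite ?_ _
      simp only [h2, Finset.mem_compl, true_and, forall_and]
    · have : ¬ (a = b ∧ (∀ s ∈ K a, i s = j' s ∧ j s = i' s) ∧
        (∀ s ∉ K a, i s = j s ∧ i' s = j' s)) := fun h => hab h.1
      rw [if_neg this]
      exact Finset.sum_eq_zero fun x _ => by simp [localCoeff, Ne.symm hab]
  · intro b _ hb
    simp [localCoeff, hb.symm]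
  · simp

variable {ι : Type*} [Fintype ι] [DecidableEq ι]

/-- A square root of the covariances of the entries at `x l, y l` of the matrices
`localTerm (K (w l)) (G (w l) ω)`: the covariance for `a, b` is the product of the values at `a, b`
and `b, a`. -/
noncomputable def halfCov (K : Fin m → Finset (Fin n)) (r : ℝ) (w : ι → Fin m)
    (x y : ι → Fin n → Fin d) (l l' : ι) : ℂ :=
  if w l = w l' ∧ ∀ s, x l s = y (if s ∈ K (w l) then l' else l) s
    then ((r : ℂ) ^ (K (w l)).card)⁻¹ else 0

/-- In a product of c l (σ l) over all letters each pair occurs twice, once from each end. Splitting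
the covariance into two halves, each with `r = √d` in place of `d`, avoids choosing an end. -/
lemma halfCov_mul_halfCov {r : ℝ} (hr : r * r = d) (w : ι → Fin m) (x y : ι → Fin n → Fin d)
    (a b : ι) :
    halfCov K r w x y a b * halfCov K r w x y b a =
    if w a = w b ∧ (∀ s ∈ K (w a), x a s = y b s ∧ y a s = x b s) ∧
      (∀ s ∉ K (w a), x a s = y a s ∧ x b s = y b s) then ((d : ℂ) ^ (K (w a)).card)⁻¹ else 0 := by
  have hr' : (d : ℂ) = r * r := by exact_mod_cast hr.symm
  have h1 : (w a = w b ∧ ∀ s, x a s = y (if s ∈ K (w a) then b else a) s) ∧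
      (w b = w a ∧ ∀ s, x b s = y (if s ∈ K (w b) then a else b) s) ↔
      w a = w b ∧ (∀ s ∈ K (w a), x a s = y b s ∧ y a s = x b s) ∧
      (∀ s ∉ K (w a), x a s = y a s ∧ x b s = y b s) := by
    constructor
    · rintro ⟨⟨h1, h2⟩, -, h3⟩
      rw [← h1] at h3
      refine ⟨h1, fun s hs => ⟨?_, ?_⟩, fun s hs => ⟨?_, ?_⟩⟩
      · simpa [hs] using h2 s
      · simpa [hs] using (h3 s).symm
      · simpa [hs] using h2 s
      · simpa [hs] using h3 s
    · rintro ⟨h1, h2, h3⟩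
      rw [← h1]
      refine ⟨⟨rfl, fun s => ?_⟩, rfl, fun s => ?_⟩ <;> by_cases hs : s ∈ K (w a)
      · simpa [hs] using (h2 s hs).1
      · simpa [hs] using (h3 s hs).1
      · simpa [hs] using (h2 s hs).2.symm
      · simpa [hs] using (h3 s hs).2
  rw [← if_congr h1 rfl rfl]
  unfold halfCov
  by_cases h2 : w a = w b ∧ ∀ s, x a s = y (if s ∈ K (w a) then b else a) s
  · by_cases h3 : w b = w a ∧ ∀ s, x b s = y (if s ∈ K (w b) then a else b) s
    · rw [if_pos h2, if_pos h3, if_pos ⟨h2, h3⟩, h3.1, ← mul_inv, ← mul_pow, hr']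
    · rw [if_neg h3, mul_zero, if_neg fun h => h3 h.2]
  · rw [if_neg h2, zero_mul, if_neg fun h => h2 h.1]

lemma memLp_prod_localTerm (hGUE : ∀ a, IsGUE (G a) P) (w : ι → Fin m) (x y : ι → Fin n → Fin d)
    (S : Finset ι) (q : ENNReal) (hq : q ≠ ⊤) :
    MemLp (fun ω => ∏ l ∈ S, localTerm (K (w l)) (G (w l) ω) (x l) (y l)) q P :=
  memLp_prod_of_gaussian
    (ξ := fun (z : (a : Fin m) × HermitianIndex (SiteIndex (K a) d)) (ω : Ω) =>
      hermitianCoord (G z.1 ω) z.2)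
    (fun z => (hGUE z.1).hasLaw_hermitianCoord z.2)
    (fun l ω => localTerm_eq_sum (fun a => (hGUE a).isHermitian) (w l) ω (x l) (y l)) S q hq

/-- The recursion of Wick's formula for the entries of the matrices `localTerm (K a) (G a ω)`. -/
theorem integral_prod_localTerm_insert (hGUE : ∀ a, IsGUE (G a) P)
    (hIndep : iIndepFun (fun (a : Fin m) (ω : Ω) (p : SiteIndex (K a) d × SiteIndex (K a) d) =>
      G a ω p.1 p.2) P) {r : ℝ} (hr : r * r = d) (w : ι → Fin m) (x y : ι → Fin n → Fin d)
    (a : ι) (S : Finset ι) (ha : a ∉ S) :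
    ∫ ω, ∏ l ∈ insert a S, localTerm (K (w l)) (G (w l) ω) (x l) (y l) ∂P =
      ∑ b ∈ S, halfCov K r w x y a b * halfCov K r w x y b a *
        ∫ ω, ∏ l ∈ S.erase b, localTerm (K (w l)) (G (w l) ω) (x l) (y l) ∂P := by
  rw [integral_prod_insert_of_gaussian (iIndepFun_hermitianCoord hGUE hIndep)
    (fun z => (hGUE z.1).hasLaw_hermitianCoord z.2)
    (fun l ω => localTerm_eq_sum (fun a => (hGUE a).isHermitian) (w l) ω (x l) (y l)) ha]
  refine Finset.sum_congr rfl fun b _ => ?_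
  rw [sum_localCoeff_mul, halfCov_mul_halfCov hr]

end LocalTerms

/-! ### Traces of words as cyclic sums -/

section CyclicSums

variable {N : Type*} [Fintype N] [DecidableEq N]

/-- The extra factor `B` makes the induction work by absorbing the last matrix; it later serves as
the letter that closes the circle. -/
lemma trace_prod_ofFn_mul {k : ℕ} (A : Fin k → Matrix N N ℂ) (B : Matrix N N ℂ) :
    ((List.ofFn A).prod * B).trace =
      ∑ i : Fin (k + 1) → N, (∏ l, A l (i l.castSucc) (i l.succ)) * B (i (Fin.last k)) (i 0) := by
  induction k generalizing B with
  | zero =>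
    simp only [List.ofFn_zero, List.prod_nil, one_mul, Matrix.trace, Matrix.diag_apply,
      Finset.univ_eq_empty, Finset.prod_empty]
    exact Fintype.sum_equiv (Equiv.funUnique (Fin 1) N).symm _ _ fun x => rfl
  | succ k ih =>
    rw [List.ofFn_succ', List.concat_eq_append, List.prod_append, List.prod_singleton, mul_assoc,
      ih, ← (Fin.snocEquiv fun _ : Fin (k + 2) => N).sum_comp, Fintype.sum_prod_type,
      Finset.sum_comm]
    refine Finset.sum_congr rfl fun i _ => ?_
    rw [Matrix.mul_apply, Finset.mul_sum]
    refine Finset.sum_congr rfl fun y _ => ?_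
    rw [Fin.prod_univ_castSucc]
    have h0 : (Fin.snocEquiv (fun _ : Fin (k + 2) => N)) (y, i) 0 = i 0 := by
      rw [← Fin.castSucc_zero]; exact Fin.snoc_castSucc (α := fun _ => N) y i 0
    have h1 : ∀ l : Fin (k + 1), (Fin.snocEquiv (fun _ : Fin (k + 2) => N)) (y, i) l.castSucc = i l :=
      fun l => Fin.snoc_castSucc (α := fun _ => N) y i l
    have h2 : (Fin.snocEquiv (fun _ : Fin (k + 2) => N)) (y, i) (Fin.last (k + 1)) = y :=
      Fin.snoc_last (α := fun _ => N) y i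
    rw [h0, h1, Fin.succ_last, h2]
    simp only [← Fin.castSucc_succ, h1]
    ring

/-- The sum of products of matrix entries along the cycles of `γ`. -/
noncomputable def cyclicSum {ι : Type*} [Fintype ι] [DecidableEq ι] {m : ℕ}
    (H : Fin m → Matrix N N ℂ) (γ : Equiv.Perm ι) (w : ι → Fin m) : ℂ :=
  ∑ i : ι → N, ∏ l, H (w l) (i l) (i (γ l))

lemma wordTrace_succ_eq_cyclicSum {k m : ℕ} (H : Fin m → Matrix N N ℂ) (w : Fin (k + 1) → Fin m) :
    wordTrace H w = cyclicSum H (finRotate (k + 1)) w / (Fintype.card N : ℂ) := by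
  unfold wordTrace normTrace cyclicSum
  congr 1
  rw [List.ofFn_succ', List.concat_eq_append, List.prod_append, List.prod_singleton,
    trace_prod_ofFn_mul]
  refine Finset.sum_congr rfl fun i _ => ?_
  rw [Fin.prod_univ_castSucc, finRotate_last]
  congr 1
  refine Finset.prod_congr rfl fun l _ => ?_
  rw [finRotate_apply, Fin.coeSucc_eq_succ]

variable {ι κ : Type*} [Fintype ι] [DecidableEq ι] [Fintype κ] [DecidableEq κ] {m : ℕ}

/-- Conjugating a Hermitian entry exchanges its indices, so the circle is traversed backwards;
reindexing by `γ⁻¹` moves the letters along. -/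
lemma star_cyclicSum {H : Fin m → Matrix N N ℂ} (hH : ∀ a, (H a).IsHermitian)
    (γ : Equiv.Perm ι) (w : ι → Fin m) :
    star (cyclicSum H γ w) = cyclicSum H γ⁻¹ (w ∘ ⇑γ⁻¹) := by
  unfold cyclicSum
  rw [star_sum]
  refine Finset.sum_congr rfl fun i _ => ?_
  rw [star_prod, ← Equiv.prod_comp γ⁻¹]
  refine Finset.prod_congr rfl fun l _ => ?_
  rw [(hH _).apply]
  simp [Equiv.Perm.inv_def]

lemma cyclicSum_mul_cyclicSum (H : Fin m → Matrix N N ℂ) (γ : Equiv.Perm ι) (w : ι → Fin m)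
    (γ' : Equiv.Perm κ) (w' : κ → Fin m) :
    cyclicSum H γ w * cyclicSum H γ' w' =
      cyclicSum H (Equiv.Perm.sumCongr γ γ') (Sum.elim w w') := by
  unfold cyclicSum
  rw [← (Equiv.sumArrowEquivProdArrow ι κ N).symm.sum_comp, Fintype.sum_prod_type,
    Finset.sum_mul_sum]
  refine Finset.sum_congr rfl fun i _ => Finset.sum_congr rfl fun j _ => ?_
  rw [Fintype.prod_sum_type]
  rfl

lemma isHermitian_localTerm {n d : ℕ} {A : Finset (Fin n)}
    {X : Matrix (SiteIndex A d) (SiteIndex A d) ℂ} (hX : X.IsHermitian) :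
    (localTerm A X).IsHermitian := by
  ext i j
  simp only [Matrix.conjTranspose_apply, localTerm, Matrix.of_apply, star_mul', hX.apply]
  congr 1
  rw [star_prod]
  refine Finset.prod_congr rfl fun s _ => ?_
  simp only [eq_comm (a := j s)]
  split_ifs <;> simp

end CyclicSums

/-! ### Covariances as sums over linking pairings -/

section Splitting

variable {ι : Type*} [Fintype ι] [DecidableEq ι]

/-- For a functional `E` with the recursion of Wick's formula, the difference between `E S` and the
product of `E` over the two parts of `S` cut out by `p` is the sum over the pairings that link the
two parts. -/
theorem sub_mul_eq_sum_pairingsOn {R : Type*} [CommRing R] {E : Finset ι → R}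
    {c : ι → ι → R} (h0 : E ∅ = 1)
    (hE : ∀ a S, a ∉ S → E (insert a S) = ∑ b ∈ S, c a b * c b a * E (S.erase b))
    (p : ι → Prop) [DecidablePred p] :
    E Finset.univ - E (Finset.univ.filter p) * E (Finset.univ.filter fun l => ¬ p l) =
      ∑ σ ∈ pairingsOn Finset.univ with ∃ l, ¬ (p l ↔ p (σ l)), ∏ l, c l (σ l) := by
  -- The product of the two restricted functionals satisfies the same recursion, with the
  -- covariances between the two sides set to zero. Its pairing sum loses exactly the linking
  -- pairings.
  have hE' := eq_sum_pairingsOn_of_recursion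
    (E := fun S => E (S.filter p) * E (S.filter fun l => ¬ p l))
    (c := fun a b => if (p a ↔ p b) then c a b else 0) (by simp [h0]) ?_ Finset.univ
  · replace hE' : E (Finset.univ.filter p) * E (Finset.univ.filter fun l => ¬ p l) = _ := hE'
    rw [hE', eq_sum_pairingsOn_of_recursion h0 hE, ← Finset.sum_sub_distrib, Finset.sum_filter]
    refine Finset.sum_congr rfl fun σ _ => ?_
    split_ifs with h
    · obtain ⟨l, hl⟩ := h
      have h0 : ∏ l, (if (p l ↔ p (σ l)) then c l (σ l) else 0) = 0 :=
        Finset.prod_eq_zero (Finset.mem_univ l) (if_neg hl)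
      rw [h0, sub_zero]
    · push Not at h
      rw [sub_eq_zero]
      exact Finset.prod_congr rfl fun l _ => (if_pos (h l)).symm
  · intro a S ha
    have hsym : ∀ b, (if (p a ↔ p b) then c a b else 0) * (if (p b ↔ p a) then c b a else 0) =
        if (p a ↔ p b) then c a b * c b a else 0 := by
      intro b
      by_cases h : p a ↔ p b
      · rw [if_pos h, if_pos h.symm, if_pos h]
      · rw [if_neg h, if_neg h, zero_mul]
    simp only [hsym]
    by_cases hpa : p a
    · have hc : ∀ b, (p a ↔ p b) ↔ p b := fun b => by simp [hpa]
      simp only [hc, ite_mul, zero_mul]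
      rw [Finset.filter_insert, if_pos hpa, Finset.filter_insert, if_neg (not_not.2 hpa),
        hE a _ (fun h => ha (Finset.mem_of_mem_filter _ h)), ← Finset.sum_filter, Finset.sum_mul]
      refine Finset.sum_congr rfl fun b hb => ?_
      have hpb := (Finset.mem_filter.1 hb).2
      rw [Finset.filter_erase, Finset.filter_erase,
        Finset.erase_eq_of_notMem (s := S.filter fun l => ¬ p l) (by simp [hpb]), mul_assoc]
    · have hc : ∀ b, (p a ↔ p b) ↔ ¬ p b := fun b => by simp [hpa]
      simp only [hc, ite_mul, zero_mul]
      rw [Finset.filter_insert, if_neg hpa, Finset.filter_insert, if_pos hpa,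
        hE a _ (fun h => ha (Finset.mem_of_mem_filter _ h)), ← Finset.sum_filter, Finset.mul_sum]
      refine Finset.sum_congr rfl fun b hb => ?_
      have hpb := (Finset.mem_filter.1 hb).2
      rw [Finset.filter_erase, Finset.filter_erase,
        Finset.erase_eq_of_notMem (s := S.filter p) (by simp [hpb])]
      ring

end Splitting

/-! ### The weight of a pairing factors over the sites -/

section PairWeight

variable {ι : Type*} [Fintype ι] [DecidableEq ι] {n m : ℕ}

/-- The restriction of an involution `σ` to a `σ`-invariant set, extended by the identity. -/
noncomputable def restrictPerm (σ : Equiv.Perm ι) (p : ι → Prop) [DecidablePred p] :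
    Equiv.Perm ι :=
  open Classical in
  if h : Function.Involutive (fun l => if p l then σ l else l) then h.toPerm else 1

lemma restrictPerm_apply {σ : Equiv.Perm ι} (hσ : σ * σ = 1) {p : ι → Prop} [DecidablePred p]
    (hp : ∀ l, p (σ l) ↔ p l) (l : ι) : restrictPerm σ p l = if p l then σ l else l := by
  have h : Function.Involutive (fun l => if p l then σ l else l) := by
    intro l
    by_cases hl : p l
    · simp [hl, hp, involution_apply_apply hσ]
    · simp [hl]
  rw [restrictPerm, dif_pos h]
  rfl

lemma restrictPerm_sq (σ : Equiv.Perm ι) (p : ι → Prop) [DecidablePred p] :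
    restrictPerm σ p * restrictPerm σ p = 1 := by
  unfold restrictPerm
  split_ifs with h
  · ext l; exact h l
  · exact one_mul 1

/-- The weight of a pairing `σ` of the letters of `w` in the expectation of a cyclic sum. -/
noncomputable def pairWeight (K : Fin m → Finset (Fin n)) (d : ℕ) (r : ℝ) (γ : Equiv.Perm ι)
    (w : ι → Fin m) (σ : Equiv.Perm ι) : ℝ :=
  if ∀ l, w (σ l) = w l then
    ∏ s, (invariantCount (γ * restrictPerm σ fun l => s ∈ K (w l)) d : ℝ) /
      r ^ (restrictPerm σ fun l => s ∈ K (w l)).support.card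
  else 0

lemma sum_prod_halfCov {K : Fin m → Finset (Fin n)} {d : ℕ} {r : ℝ} (γ : Equiv.Perm ι)
    (w : ι → Fin m) {σ : Equiv.Perm ι} (hσ : σ ∈ pairingsOn Finset.univ) :
    ∑ i : ι → Fin n → Fin d, ∏ l, halfCov K r w i (fun l => i (γ l)) l (σ l) =
      (pairWeight K d r γ w σ : ℂ) := by
  obtain ⟨hσ1, hσ2⟩ := mem_pairingsOn.1 hσ
  unfold pairWeight
  split_ifs with hw
  swap
  · push Not at hw
    obtain ⟨l, hl⟩ := hw
    rw [Complex.ofReal_zero]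
    refine Finset.sum_eq_zero fun i _ => Finset.prod_eq_zero (Finset.mem_univ l) ?_
    exact if_neg fun h => hl h.1.symm
  have hap : ∀ s l, restrictPerm σ (fun l => s ∈ K (w l)) l = if s ∈ K (w l) then σ l else l :=
    fun s l => restrictPerm_apply hσ1 (fun l => by rw [hw]) l
  -- For a fixed site s, the Kronecker deltas of all letters together say that the s-th coordinate
  -- is constant along the cycles of γσ_s.
  have h1 : ∀ i : ι → Fin n → Fin d, ∏ l, halfCov K r w i (fun l => i (γ l)) l (σ l) =
      if ∀ s l, i ((γ * restrictPerm σ fun l => s ∈ K (w l)) l) s = i l s then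
        ∏ l, ((r : ℂ) ^ (K (w l)).card)⁻¹ else 0 := by
    intro i
    have h2 : (∀ s l, i ((γ * restrictPerm σ fun l => s ∈ K (w l)) l) s = i l s) ↔
        ∀ l ∈ Finset.univ, w l = w (σ l) ∧
          ∀ s, i l s = i (γ (if s ∈ K (w l) then σ l else l)) s := by
      simp only [Equiv.Perm.mul_apply, hap, hw, Finset.mem_univ, forall_true_left, true_and]
      rw [forall_comm]
      simp only [eq_comm]
    rw [if_congr h2 rfl rfl]
    simp only [halfCov]
    rw [Finset.prod_ite_zero]
    congr
  simp only [h1]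
  rw [← Finset.sum_filter, Finset.sum_const, nsmul_eq_mul]
  have h3 : (Finset.univ.filter fun i : ι → Fin n → Fin d =>
      ∀ s l, i ((γ * restrictPerm σ fun l => s ∈ K (w l)) l) s = i l s).card =
      ∏ s, invariantCount (γ * restrictPerm σ fun l => s ∈ K (w l)) d := by
    unfold invariantCount
    rw [← Fintype.card_piFinset]
    refine Finset.card_nbij' (fun i s l => i l s) (fun x l s => x s l) ?_ ?_ ?_ ?_
    · exact fun i hi => Fintype.mem_piFinset.2 fun s =>
        Finset.mem_filter.2 ⟨Finset.mem_univ _, (Finset.mem_filter.1 hi).2 s⟩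
    · exact fun x hx => Finset.mem_filter.2 ⟨Finset.mem_univ _, fun s =>
        (Finset.mem_filter.1 (Fintype.mem_piFinset.1 hx s)).2⟩
    · intro i _; rfl
    · intro x _; rfl
  -- Double counting of the incidences between letters and sites; as σ has no fixed point, supp σ_s
  -- consists of all letters whose set contains s.
  have h4 : ∏ l, (r : ℂ) ^ (K (w l)).card =
      ∏ s, (r : ℂ) ^ (restrictPerm σ fun l => s ∈ K (w l)).support.card := by
    have h5 : ∀ l, (r : ℂ) ^ (K (w l)).card = ∏ s, if s ∈ K (w l) then (r : ℂ) else 1 := by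
      intro l
      rw [Finset.prod_ite_mem, Finset.univ_inter, Finset.prod_const]
    simp only [h5]
    rw [Finset.prod_comm]
    refine Finset.prod_congr rfl fun s _ => ?_
    rw [← Finset.prod_filter, Finset.prod_const]
    congr 2
    ext l
    have hl : σ l ≠ l := by rw [← Equiv.Perm.mem_support, hσ2]; exact Finset.mem_univ l
    simp [hap, hl]
  rw [h3, Finset.prod_inv_distrib, h4, Finset.prod_div_distrib]
  push_cast
  rfl

end PairWeight

/-! ### Genus expansions of expectations and covariances -/

section Expectations

variable {Ω : Type*} [MeasurableSpace Ω] {P : Measure Ω} [IsProbabilityMeasure P]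
  {n m d : ℕ} {K : Fin m → Finset (Fin n)}
  {G : (a : Fin m) → Ω → Matrix (SiteIndex (K a) d) (SiteIndex (K a) d) ℂ}
  {ι κ : Type*} [Fintype ι] [DecidableEq ι] [Fintype κ] [DecidableEq κ]

lemma memLp_cyclicSum (hGUE : ∀ a, IsGUE (G a) P) (γ : Equiv.Perm ι) (w : ι → Fin m)
    (q : ENNReal) (hq : q ≠ ⊤) :
    MemLp (fun ω => cyclicSum (fun a => localTerm (K a) (G a ω)) γ w) q P :=
  memLp_finsetSum _ fun i _ => memLp_prod_localTerm hGUE w i (fun l => i (γ l)) Finset.univ q hq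

lemma integral_cyclicSum_eq_sum_integral (hGUE : ∀ a, IsGUE (G a) P) (γ : Equiv.Perm ι)
    (w : ι → Fin m) :
    ∫ ω, cyclicSum (fun a => localTerm (K a) (G a ω)) γ w ∂P =
      ∑ i : ι → Fin n → Fin d, ∫ ω, ∏ l, localTerm (K (w l)) (G (w l) ω) (i l) (i (γ l)) ∂P :=
  integral_finsetSum _ fun i _ => memLp_one_iff_integrable.1
    (memLp_prod_localTerm hGUE w i (fun l => i (γ l)) Finset.univ 1 (by simp))

/-- The genus expansion of the expectation of a cyclic sum. -/
theorem integral_cyclicSum (hGUE : ∀ a, IsGUE (G a) P)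
    (hIndep : iIndepFun (fun (a : Fin m) (ω : Ω) (p : SiteIndex (K a) d × SiteIndex (K a) d) =>
      G a ω p.1 p.2) P) {r : ℝ} (hr : r * r = d) (γ : Equiv.Perm ι) (w : ι → Fin m) :
    ∫ ω, cyclicSum (fun a => localTerm (K a) (G a ω)) γ w ∂P =
      ((∑ σ ∈ pairingsOn Finset.univ, pairWeight K d r γ w σ : ℝ) : ℂ) := by
  rw [integral_cyclicSum_eq_sum_integral hGUE]
  have h1 : ∀ i : ι → Fin n → Fin d,
      ∫ ω, ∏ l, localTerm (K (w l)) (G (w l) ω) (i l) (i (γ l)) ∂P =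
      ∑ σ ∈ pairingsOn Finset.univ, ∏ l, halfCov K r w i (fun l => i (γ l)) l (σ l) := fun i =>
    eq_sum_pairingsOn_of_recursion
      (E := fun S => ∫ ω, ∏ l ∈ S, localTerm (K (w l)) (G (w l) ω) (i l) (i (γ l)) ∂P)
      (by simp) (fun a S ha => integral_prod_localTerm_insert hGUE hIndep hr w i
        (fun l => i (γ l)) a S ha) Finset.univ
  simp only [h1]
  rw [Finset.sum_comm, Complex.ofReal_sum]
  exact Finset.sum_congr rfl fun σ hσ => sum_prod_halfCov γ w hσ

/-- The genus expansion of the covariance of two cyclic sums: only the pairings that link the two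
circles contribute. -/
theorem integral_cyclicSum_mul_sub (hGUE : ∀ a, IsGUE (G a) P)
    (hIndep : iIndepFun (fun (a : Fin m) (ω : Ω) (p : SiteIndex (K a) d × SiteIndex (K a) d) =>
      G a ω p.1 p.2) P) {r : ℝ} (hr : r * r = d) (γ : Equiv.Perm ι) (w : ι → Fin m)
    (γ' : Equiv.Perm κ) (w' : κ → Fin m) :
    ∫ ω, cyclicSum (fun a => localTerm (K a) (G a ω)) γ w *
        cyclicSum (fun a => localTerm (K a) (G a ω)) γ' w' ∂P -
      (∫ ω, cyclicSum (fun a => localTerm (K a) (G a ω)) γ w ∂P) *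
        ∫ ω, cyclicSum (fun a => localTerm (K a) (G a ω)) γ' w' ∂P =
      ((∑ σ ∈ pairingsOn (Finset.univ : Finset (ι ⊕ κ)) with
          ∃ l, ¬ (l.isLeft = true ↔ (σ l).isLeft = true),
        pairWeight K d r (Equiv.Perm.sumCongr γ γ') (Sum.elim w w') σ : ℝ) : ℂ) := by
  simp only [cyclicSum_mul_cyclicSum]
  simp only [integral_cyclicSum_eq_sum_integral hGUE]
  set Γ := Equiv.Perm.sumCongr γ γ' with hΓ
  set W := Sum.elim w w' with hW
  set E : (ι ⊕ κ → Fin n → Fin d) → Finset (ι ⊕ κ) → ℂ := fun i S =>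
    ∫ ω, ∏ l ∈ S, localTerm (K (W l)) (G (W l) ω) (i l) (i (Γ l)) ∂P with hE
  have h1 : (∑ i : ι → Fin n → Fin d,
        ∫ ω, ∏ l, localTerm (K (w l)) (G (w l) ω) (i l) (i (γ l)) ∂P) *
      (∑ i : κ → Fin n → Fin d,
        ∫ ω, ∏ l, localTerm (K (w' l)) (G (w' l) ω) (i l) (i (γ' l)) ∂P) =
      ∑ i : ι ⊕ κ → Fin n → Fin d, E i (Finset.univ.filter fun l => l.isLeft = true) *
        E i (Finset.univ.filter fun l => ¬ l.isLeft = true) := by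
    rw [← (Equiv.sumArrowEquivProdArrow ι κ (Fin n → Fin d)).symm.sum_comp, Fintype.sum_prod_type,
      Finset.sum_mul_sum]
    refine Finset.sum_congr rfl fun i _ => Finset.sum_congr rfl fun j _ => ?_
    simp only [hE, Finset.prod_filter, Fintype.prod_sum_type]
    simp [hΓ]
    rfl
  rw [h1, ← Finset.sum_sub_distrib]
  have h2 : ∀ i : ι ⊕ κ → Fin n → Fin d,
      ∫ ω, ∏ l, localTerm (K (W l)) (G (W l) ω) (i l) (i (Γ l)) ∂P -
        E i (Finset.univ.filter fun l => l.isLeft = true) *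
          E i (Finset.univ.filter fun l => ¬ l.isLeft = true) =
      ∑ σ ∈ pairingsOn (Finset.univ : Finset (ι ⊕ κ)) with
          ∃ l, ¬ (l.isLeft = true ↔ (σ l).isLeft = true),
        ∏ l, halfCov K r W i (fun l => i (Γ l)) l (σ l) := fun i =>
    sub_mul_eq_sum_pairingsOn (E := E i) (by simp [hE]) (fun a S ha =>
      integral_prod_localTerm_insert hGUE hIndep hr W i (fun l => i (Γ l)) a S ha)
      fun l => l.isLeft = true
  rw [Finset.sum_congr rfl fun i _ => h2 i, Finset.sum_comm, Complex.ofReal_sum]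
  exact Finset.sum_congr rfl fun σ hσ => sum_prod_halfCov Γ W (Finset.mem_of_mem_filter _ hσ)

end Expectations

/-! ### Pair partitions as fixed-point-free involutions -/

section PairPartitions

variable {k : ℕ}

open Classical in
/-- The partition into the orbits of an involution. -/
noncomputable def involutionPartition (σ : Equiv.Perm (Fin k)) :
    Finpartition (Finset.univ : Finset (Fin k)) :=
  Finpartition.ofSetoid (SameCycle.setoid σ)

lemma sameCycle_involution_iff {ι : Type*} {σ : Equiv.Perm ι} (hσ : σ * σ = 1) {a b : ι} :
    σ.SameCycle a b ↔ b = a ∨ b = σ a := by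
  constructor
  · rintro ⟨i, rfl⟩
    have h2 : σ ^ (2 : ℤ) = 1 := by rw [zpow_two, hσ]
    rcases Int.even_or_odd' i with ⟨j, rfl | rfl⟩
    · left; rw [zpow_mul, h2, one_zpow, Equiv.Perm.one_apply]
    · right; rw [zpow_add, zpow_mul, h2, one_zpow, one_mul, zpow_one]
  · rintro (rfl | rfl)
    · exact SameCycle.refl _ _
    · exact sameCycle_apply_right.2 (SameCycle.refl _ _)

lemma part_involutionPartition {σ : Equiv.Perm (Fin k)} (hσ : σ * σ = 1) (a : Fin k) :
    (involutionPartition σ).part a = {a, σ a} := by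
  classical
  ext b
  rw [involutionPartition, Finpartition.mem_part_ofSetoid_iff_rel, Finset.mem_insert,
    Finset.mem_singleton]
  exact sameCycle_involution_iff hσ

lemma finpartition_ext_of_part {α β : Finpartition (Finset.univ : Finset (Fin k))}
    (h : ∀ a, α.part a = β.part a) : α = β := by
  have key : ∀ {α β : Finpartition (Finset.univ : Finset (Fin k))},
      (∀ a, α.part a = β.part a) → α ≤ β := by
    intro α β h B hB
    obtain ⟨a, ha⟩ := α.nonempty_of_mem_parts hB
    refine ⟨β.part a, β.part_mem.2 (Finset.mem_univ a), ?_⟩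
    rw [← h, α.part_eq_of_mem hB ha]
  exact le_antisymm (key h) (key fun a => (h a).symm)

lemma le_wordKer_iff {m : ℕ} {w : Fin k → Fin m}
    {α : Finpartition (Finset.univ : Finset (Fin k))} :
    α ≤ wordKer w ↔ ∀ a, ∀ b ∈ α.part a, w b = w a := by
  classical
  constructor
  · intro h a b hb
    obtain ⟨C, hC, hle⟩ := h (α.part_mem.2 (Finset.mem_univ a))
    have ha : a ∈ C := hle (α.mem_part (Finset.mem_univ a))
    have hb' : b ∈ (wordKer w).part a := by
      rw [(wordKer w).part_eq_of_mem hC ha]; exact hle hb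
    rw [wordKer, Finpartition.mem_part_ofSetoid_iff_rel] at hb'
    exact hb'.symm
  · intro h B hB
    obtain ⟨a, ha⟩ := α.nonempty_of_mem_parts hB
    refine ⟨(wordKer w).part a, (wordKer w).part_mem.2 (Finset.mem_univ a), fun b hb => ?_⟩
    rw [wordKer, Finpartition.mem_part_ofSetoid_iff_rel]
    rw [← α.part_eq_of_mem hB ha] at hb
    exact (h a b hb).symm

variable {n m : ℕ}

/-- The involutions that describe the `(ε, w)`-noncrossing pair partitions. -/
def IsLocallyNoncrossing (K : Fin m → Finset (Fin n)) (w : Fin k → Fin m)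
    (σ : Equiv.Perm (Fin k)) : Prop :=
  (∀ l, w (σ l) = w l) ∧
    ∀ s, IsNoncrossingInvolution (restrictPerm σ fun l => s ∈ K (w l))

/-- A crossing of two pairs violates the ε-condition exactly when their letters share a site s, and
then both pairs survive in the restriction to s and cross there. -/
lemma isEpsNoncrossing_involutionPartition_iff {K : Fin m → Finset (Fin n)} {w : Fin k → Fin m}
    {σ : Equiv.Perm (Fin k)} (hσ : σ * σ = 1) (hw : ∀ l, w (σ l) = w l) :
    IsEpsNoncrossing (epsilonMatrix K) w (involutionPartition σ) ↔
      ∀ s, IsNoncrossingInvolution (restrictPerm σ fun l => s ∈ K (w l)) := by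
  have hap : ∀ s l, restrictPerm σ (fun l => s ∈ K (w l)) l = if s ∈ K (w l) then σ l else l :=
    fun s l => restrictPerm_apply hσ (fun l => by rw [hw]) l
  have hpart : ∀ i j : Fin k, i < j →
      ((involutionPartition σ).part i = (involutionPartition σ).part j ↔ σ i = j) := by
    intro i j hij
    rw [eq_comm, ← Finpartition.mem_part_iff_part_eq_part _ (Finset.mem_univ _) (Finset.mem_univ _),
      part_involutionPartition hσ, Finset.mem_insert, Finset.mem_singleton]
    constructor
    · rintro (h | h)
      · exact absurd h hij.ne'
      · exact h.symm
    · intro h; exact Or.inr h.symm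
  constructor
  · intro h s i p j q hip hpj hjq hij hpq
    rw [hap] at hij hpq
    split_ifs at hij with hi
    swap
    · exact (hip.trans hpj).ne hij
    split_ifs at hpq with hp
    swap
    · exact (hpj.trans hjq).ne hpq
    have h1 := h i p j q hip hpj hjq ((hpart i j (hip.trans hpj)).2 hij) ?_
      ((hpart p q (hpj.trans hjq)).2 hpq)
    · simp only [epsilonMatrix, Matrix.of_apply] at h1
      split_ifs at h1 with h2
      · exact Finset.notMem_empty s (h2 ▸ Finset.mem_inter.2 ⟨hi, hp⟩)
    · intro h3
      rw [eq_comm, hpart p j hpj, hpq] at h3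
      exact hjq.ne' h3
  · intro h i p j q hip hpj hjq hij _ hpq
    rw [hpart i j (hip.trans hpj)] at hij
    rw [hpart p q (hpj.trans hjq)] at hpq
    simp only [epsilonMatrix, Matrix.of_apply]
    rw [if_pos]
    by_contra hne
    obtain ⟨s, hs⟩ := Finset.nonempty_iff_ne_empty.2 hne
    obtain ⟨hi, hp⟩ := Finset.mem_inter.1 hs
    exact h s i p j q hip hpj hjq (by rw [hap, if_pos hi, hij]) (by rw [hap, if_pos hp, hpq])

lemma exists_involution_of_card_parts {α : Finpartition (Finset.univ : Finset (Fin k))}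
    (hα : ∀ B ∈ α.parts, B.card = 2) :
    ∃ σ ∈ pairingsOn (Finset.univ : Finset (Fin k)), involutionPartition σ = α := by
  have h1 : ∀ a, ∃ b, b ≠ a ∧ α.part a = {a, b} := by
    intro a
    obtain ⟨x, y, hxy, h⟩ := Finset.card_eq_two.1 (hα _ (α.part_mem.2 (Finset.mem_univ a)))
    have ha : a ∈ α.part a := α.mem_part (Finset.mem_univ a)
    rw [h, Finset.mem_insert, Finset.mem_singleton] at ha
    rcases ha with rfl | rfl
    · exact ⟨y, hxy.symm, h⟩
    · exact ⟨x, hxy, by rw [h, Finset.pair_comm]⟩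
  choose f hf1 hf2 using h1
  have hinv : Function.Involutive f := by
    intro a
    have h2 : f a ∈ α.part a := by rw [hf2]; simp
    rw [Finpartition.mem_part_iff_part_eq_part _ (Finset.mem_univ _) (Finset.mem_univ _)] at h2
    have h3 : f (f a) ∈ α.part (f a) := by rw [hf2 (f a)]; simp
    rw [h2, hf2 a, Finset.mem_insert, Finset.mem_singleton] at h3
    exact h3.resolve_right (hf1 (f a))
  have hσ : hinv.toPerm * hinv.toPerm = 1 := Equiv.ext fun a => hinv a
  refine ⟨hinv.toPerm, mem_pairingsOn.2 ⟨hσ, ?_⟩, ?_⟩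
  · ext a
    simpa using hf1 a
  · refine finpartition_ext_of_part fun a => ?_
    rw [part_involutionPartition hσ, hf2]
    rfl

open Classical in
theorem card_epsNC₂ (K : Fin m → Finset (Fin n)) (w : Fin k → Fin m) :
    (epsNC₂ (epsilonMatrix K) w).card =
      ((pairingsOn (Finset.univ : Finset (Fin k))).filter (IsLocallyNoncrossing K w)).card := by
  symm
  have hle : ∀ {σ : Equiv.Perm (Fin k)}, σ * σ = 1 →
      (involutionPartition σ ≤ wordKer w ↔ ∀ l, w (σ l) = w l) := by
    intro σ hσ
    rw [le_wordKer_iff]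
    simp [part_involutionPartition hσ]
  refine Finset.card_nbij involutionPartition ?_ ?_ ?_
  · intro σ hσ
    obtain ⟨h1, hw, hs⟩ := Finset.mem_filter.1 hσ
    obtain ⟨h2, h3⟩ := mem_pairingsOn.1 h1
    refine Finset.mem_filter.2 ⟨Finset.mem_filter.2 ⟨Finset.mem_univ _, (hle h2).2 hw,
      (isEpsNoncrossing_involutionPartition_iff h2 hw).2 hs⟩, fun B hB => ?_⟩
    obtain ⟨a, ha⟩ := (involutionPartition σ).nonempty_of_mem_parts hB
    have ha' : σ a ≠ a := by rw [← Equiv.Perm.mem_support, h3]; exact Finset.mem_univ a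
    rw [← (involutionPartition σ).part_eq_of_mem hB ha, part_involutionPartition h2,
      Finset.card_pair ha'.symm]
  · intro σ hσ τ hτ h
    obtain ⟨h2, h3⟩ := mem_pairingsOn.1 (Finset.mem_filter.1 hσ).1
    obtain ⟨h2', -⟩ := mem_pairingsOn.1 (Finset.mem_filter.1 hτ).1
    ext1 a
    have ha' : σ a ≠ a := by rw [← Equiv.Perm.mem_support, h3]; exact Finset.mem_univ a
    have h4 : σ a ∈ (involutionPartition τ).part a := by
      rw [← h, part_involutionPartition h2]; simp
    rw [part_involutionPartition h2', Finset.mem_insert, Finset.mem_singleton] at h4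
    exact h4.resolve_left ha'
  · intro α hα
    obtain ⟨h1, h2⟩ := Finset.mem_filter.1 hα
    obtain ⟨-, h3, h4⟩ := Finset.mem_filter.1 h1
    obtain ⟨σ, hσ, rfl⟩ := exists_involution_of_card_parts h2
    have hσ2 := (mem_pairingsOn.1 hσ).1
    have hw := (hle hσ2).1 h3
    exact ⟨σ, Finset.mem_filter.2 ⟨hσ, hw,
      (isEpsNoncrossing_involutionPartition_iff hσ2 hw).1 h4⟩, rfl⟩

end PairPartitions

/-! ### Bounds for the weights on one and on two circles -/

section WeightBounds

variable {n m : ℕ} {K : Fin m → Finset (Fin n)} {d : ℕ}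

lemma pairWeight_nonneg {ι : Type*} [Fintype ι] [DecidableEq ι] (γ : Equiv.Perm ι)
    (w : ι → Fin m) (σ : Equiv.Perm ι) {r : ℝ} (hr : 0 ≤ r) : 0 ≤ pairWeight K d r γ w σ := by
  unfold pairWeight
  split_ifs
  · exact Finset.prod_nonneg fun s _ => div_nonneg (Nat.cast_nonneg _) (pow_nonneg hr _)
  · exact le_rfl

lemma pairWeight_finRotate_of_noncrossing {k : ℕ} (hd : 0 < d) {w : Fin (k + 1) → Fin m}
    {σ : Equiv.Perm (Fin (k + 1))} (hnc : IsLocallyNoncrossing K w σ) :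
    pairWeight K d (√d) (finRotate (k + 1)) w σ = (d : ℝ) ^ n := by
  have hr : √(d : ℝ) * √d = d := Real.mul_self_sqrt (Nat.cast_nonneg d)
  have hr0 : 0 < √(d : ℝ) := Real.sqrt_pos.2 (Nat.cast_pos.2 hd)
  rw [pairWeight, if_pos hnc.1]
  have h : ∀ s, (invariantCount (finRotate (k + 1) * restrictPerm σ fun l => s ∈ K (w l)) d : ℝ) /
      √d ^ (restrictPerm σ fun l => s ∈ K (w l)).support.card = d := fun s => by
    rw [invariantCount_finRotate_mul_of_noncrossing d hr (restrictPerm_sq _ _) (hnc.2 s),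
      mul_div_assoc, div_self (pow_pos hr0 _).ne', mul_one]
  simp only [h]
  rw [Finset.prod_const, Finset.card_univ, Fintype.card_fin]

/-- A site with a crossing contributes at most 1 and every other site at most `d`. -/
lemma pairWeight_finRotate_of_crossing {k : ℕ} (hd : 0 < d) {w : Fin (k + 1) → Fin m}
    {σ : Equiv.Perm (Fin (k + 1))} (hnc : ¬ IsLocallyNoncrossing K w σ) :
    pairWeight K d (√d) (finRotate (k + 1)) w σ ≤ (d : ℝ) ^ n / d := by
  have hr : √(d : ℝ) * √d = d := Real.mul_self_sqrt (Nat.cast_nonneg d)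
  have hr0 : 0 < √(d : ℝ) := Real.sqrt_pos.2 (Nat.cast_pos.2 hd)
  have hd0 : (0 : ℝ) < d := Nat.cast_pos.2 hd
  unfold pairWeight
  split_ifs with hw
  swap
  · positivity
  obtain ⟨s, hs⟩ : ∃ s, ¬ IsNoncrossingInvolution (restrictPerm σ fun l => s ∈ K (w l)) := by
    by_contra! h; exact hnc ⟨hw, h⟩
  unfold IsNoncrossingInvolution at hs
  push Not at hs
  obtain ⟨i, p, j, q, hip, hpj, hjq, hij, hpq, -⟩ := hs
  have hn : 0 < n := s.pos
  have hcard : (d : ℝ) ^ n / d = 1 * ∏ _t ∈ Finset.univ.erase s, (d : ℝ) := by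
    rw [Finset.prod_const, Finset.card_erase_of_mem (Finset.mem_univ s), Finset.card_univ,
      Fintype.card_fin, one_mul, div_eq_iff hd0.ne', ← pow_succ, Nat.sub_add_cancel hn]
  rw [hcard, ← Finset.mul_prod_erase _ _ (Finset.mem_univ s)]
  refine mul_le_mul ?_ (Finset.prod_le_prod (fun t _ => by positivity) fun t _ => ?_)
    (Finset.prod_nonneg fun t _ => by positivity) zero_le_one
  · rw [div_le_one (pow_pos hr0 _)]
    exact invariantCount_finRotate_mul_le_of_crossing hd hr0.le hr (restrictPerm_sq _ _)
      hip hpj hjq hij hpq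
  · rw [div_le_iff₀ (pow_pos hr0 _)]
    have := invariantCount_mul_involution_le hd hr0.le hr (finRotate (k + 1))
      (restrictPerm_sq σ fun l => t ∈ K (w l))
    rwa [invariantCount_finRotate] at this

/-- A site at which a linking pair is visible contributes at most 1, every other site at most `d *
d`. -/
lemma pairWeight_sumCongr_finRotate_le (hK : ∀ a, (K a).Nonempty) {k : ℕ} (hd : 0 < d)
    {w : Fin (k + 1) ⊕ Fin (k + 1) → Fin m}
    {σ : Equiv.Perm (Fin (k + 1) ⊕ Fin (k + 1))} (hσ : σ * σ = 1)
    (hlink : ∃ l, ¬ (l.isLeft = true ↔ (σ l).isLeft = true)) :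
    pairWeight K d (√d) (Equiv.Perm.sumCongr (finRotate (k + 1)) (finRotate (k + 1))⁻¹) w σ ≤
      ((d : ℝ) ^ n) ^ 2 / d ^ 2 := by
  have hr : √(d : ℝ) * √d = d := Real.mul_self_sqrt (Nat.cast_nonneg d)
  have hr0 : 0 < √(d : ℝ) := Real.sqrt_pos.2 (Nat.cast_pos.2 hd)
  have hd0 : (0 : ℝ) < d := Nat.cast_pos.2 hd
  set Γ := Equiv.Perm.sumCongr (finRotate (k + 1)) (finRotate (k + 1))⁻¹ with hΓ
  have hΓd : invariantCount Γ d = d * d := by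
    rw [hΓ, invariantCount_sumCongr, invariantCount_inv, invariantCount_finRotate]
  unfold pairWeight
  split_ifs with hw
  swap
  · positivity
  obtain ⟨l, hl⟩ := hlink
  -- Nonemptiness of the sets of sites makes the linking pair visible somewhere.
  obtain ⟨s, hs⟩ := hK (w l)
  have hn : 0 < n := s.pos
  have hcard : ((d : ℝ) ^ n) ^ 2 / d ^ 2 = 1 * ∏ _t ∈ Finset.univ.erase s, ((d : ℝ) * d) := by
    rw [Finset.prod_const, Finset.card_erase_of_mem (Finset.mem_univ s), Finset.card_univ,
      Fintype.card_fin, one_mul, div_eq_iff (by positivity), ← pow_two, ← pow_mul, ← pow_mul,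
      ← pow_add]
    congr 1
    omega
  rw [hcard, ← Finset.mul_prod_erase _ _ (Finset.mem_univ s)]
  refine mul_le_mul ?_ (Finset.prod_le_prod (fun t _ => by positivity) fun t _ => ?_)
    (Finset.prod_nonneg fun t _ => by positivity) zero_le_one
  · rw [div_le_one (pow_pos hr0 _)]
    refine invariantCount_mul_involution_le_of_not_sameCycle hd hr0.le hr hΓd (restrictPerm_sq _ _)
      (a := l) ?_
    rw [restrictPerm_apply hσ (fun l => by rw [hw]), if_pos hs]
    -- The circle containing l is invariant under Γ, and the partner of l lies on the other one.
    refine not_sameCycle_of_invariant (T := {x : Fin (k + 1) ⊕ Fin (k + 1) |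
      l.isLeft = true ↔ x.isLeft = true}) ?_ Iff.rfl hl
    rintro (x | x) hx
    · exact hx
    · exact hx
  · rw [div_le_iff₀ (pow_pos hr0 _)]
    have := invariantCount_mul_involution_le hd hr0.le hr Γ
      (restrictPerm_sq σ fun l => t ∈ K (w l))
    rw [hΓd] at this
    exact_mod_cast this

end WeightBounds

/-! ### Expectation and variance of the trace of a word -/

section WordTraces

variable {Ω : Type*} [MeasurableSpace Ω] {P : Measure Ω} [IsProbabilityMeasure P]
  {n m : ℕ} {K : Fin m → Finset (Fin n)}

lemma wordTrace_fin_zero {N : Type*} [Fintype N] [DecidableEq N] {m : ℕ}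
    (H : Fin m → Matrix N N ℂ) (w : Fin 0 → Fin m) :
    wordTrace H w = (Fintype.card N : ℂ) / Fintype.card N := by
  simp [wordTrace, normTrace]

lemma wordTrace_succ_eq {k d : ℕ} (X : (a : Fin m) → Matrix (SiteIndex (K a) d) (SiteIndex (K a) d) ℂ)
    (w : Fin (k + 1) → Fin m) :
    wordTrace (fun a => localTerm (K a) (X a)) w =
      cyclicSum (fun a => localTerm (K a) (X a)) (finRotate (k + 1)) w / ((d : ℂ) ^ n) := by
  rw [wordTrace_succ_eq_cyclicSum]
  simp

lemma memLp_wordTrace {d k : ℕ}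
    {G : (a : Fin m) → Ω → Matrix (SiteIndex (K a) d) (SiteIndex (K a) d) ℂ}
    (hGUE : ∀ a, IsGUE (G a) P) (w : Fin k → Fin m) (q : ENNReal) (hq : q ≠ ⊤) :
    MemLp (fun ω => wordTrace (fun a => localTerm (K a) (G a ω)) w) q P := by
  rcases k with _ | k
  · simp only [wordTrace_fin_zero]
    exact memLp_const _
  · simp only [wordTrace_succ_eq, div_eq_mul_inv]
    exact (memLp_cyclicSum hGUE _ _ q hq).mul_const _

lemma integral_norm_sub_sq_eq {Y : Ω → ℂ} (hY : MemLp Y 2 P) :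
    ((∫ ω, ‖Y ω - ∫ ω', Y ω' ∂P‖ ^ 2 ∂P : ℝ) : ℂ) =
      ∫ ω, Y ω * star (Y ω) ∂P - (∫ ω, Y ω ∂P) * ∫ ω, star (Y ω) ∂P := by
  have hint : Integrable Y P := hY.integrable (by norm_num)
  have hstar : Integrable (fun ω => star (Y ω)) P :=
    (Complex.conjLIE.toContinuousLinearEquiv.toContinuousLinearMap.integrable_comp hint)
  have hmul : Integrable (fun ω => Y ω * star (Y ω)) P := by
    have h1 : Integrable (fun ω => ((‖Y ω‖ ^ 2 : ℝ) : ℂ)) P :=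
      (hY.integrable_norm_pow (by norm_num)).ofReal
    refine h1.congr (ae_of_all _ fun ω => ?_)
    simp only [Complex.star_def, Complex.mul_conj, Complex.normSq_eq_norm_sq]
  have hs : ∫ ω, star (Y ω) ∂P = star (∫ ω, Y ω ∂P) := integral_conj
  set c := ∫ ω, Y ω ∂P with hc
  rw [← integral_complex_ofReal]
  have h1 : ∀ ω, ((‖Y ω - c‖ ^ 2 : ℝ) : ℂ) =
      Y ω * star (Y ω) - c * star (Y ω) - (Y ω * star c - c * star c) := by
    intro ω
    rw [← Complex.normSq_eq_norm_sq, ← Complex.mul_conj]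
    simp only [Complex.star_def, map_sub]
    ring
  simp only [h1]
  have hA : Integrable (fun ω => Y ω * star (Y ω) - c * star (Y ω)) P :=
    hmul.sub (hstar.const_mul c)
  have hB : Integrable (fun ω => Y ω * star c - c * star c) P :=
    (hint.mul_const _).sub (integrable_const _)
  rw [integral_sub hA hB, integral_sub hmul (hstar.const_mul c), integral_sub (hint.mul_const _) (integrable_const _),
    integral_const_mul, integral_mul_const, hs, ← hc]
  simp

/-- The variance is the covariance of the trace with its conjugate, again a cyclic sum. The constant
bounds the number of linking pairings by that of all pairings of the 2(k + 1) letters. -/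
lemma variance_wordTrace_le (hK : ∀ a, (K a).Nonempty) {d k : ℕ} (hd : 0 < d)
    {G : (a : Fin m) → Ω → Matrix (SiteIndex (K a) d) (SiteIndex (K a) d) ℂ}
    (hGUE : ∀ a, IsGUE (G a) P)
    (hIndep : iIndepFun (fun (a : Fin m) (ω : Ω) (p : SiteIndex (K a) d × SiteIndex (K a) d) =>
      G a ω p.1 p.2) P) (w : Fin (k + 1) → Fin m) :
    ∫ ω, ‖wordTrace (fun a => localTerm (K a) (G a ω)) w -
        ∫ ω', wordTrace (fun a => localTerm (K a) (G a ω')) w ∂P‖ ^ 2 ∂P ≤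
      (pairingsOn (Finset.univ : Finset (Fin (k + 1) ⊕ Fin (k + 1)))).card * ((d : ℝ) ^ 2)⁻¹ := by
  have hr : √(d : ℝ) * √d = d := Real.mul_self_sqrt (Nat.cast_nonneg d)
  have hd0 : (0 : ℝ) < d := Nat.cast_pos.2 hd
  have h1 := integral_norm_sub_sq_eq (memLp_wordTrace hGUE w 2 (by simp))
  have h2 : ∀ ω, star (wordTrace (fun a => localTerm (K a) (G a ω)) w) =
      cyclicSum (fun a => localTerm (K a) (G a ω)) (finRotate (k + 1))⁻¹
        (w ∘ ⇑(finRotate (k + 1))⁻¹) / ((d : ℂ) ^ n) := by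
    intro ω
    rw [wordTrace_succ_eq, star_div₀,
      star_cyclicSum fun a => isHermitian_localTerm ((hGUE a).isHermitian ω)]
    simp
  have h3 := integral_cyclicSum_mul_sub hGUE hIndep hr (finRotate (k + 1)) w
    (finRotate (k + 1))⁻¹ (w ∘ ⇑(finRotate (k + 1))⁻¹)
  set S := ∑ σ ∈ pairingsOn (Finset.univ : Finset (Fin (k + 1) ⊕ Fin (k + 1))) with
      ∃ l, ¬ (l.isLeft = true ↔ (σ l).isLeft = true),
    pairWeight K d (√d) (Equiv.Perm.sumCongr (finRotate (k + 1)) (finRotate (k + 1))⁻¹)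
      (Sum.elim w (w ∘ ⇑(finRotate (k + 1))⁻¹)) σ with hS
  have h4 : ∫ ω, ‖wordTrace (fun a => localTerm (K a) (G a ω)) w -
        ∫ ω', wordTrace (fun a => localTerm (K a) (G a ω')) w ∂P‖ ^ 2 ∂P =
      S / ((d : ℝ) ^ n) ^ 2 := by
    have : ((∫ ω, ‖wordTrace (fun a => localTerm (K a) (G a ω)) w -
        ∫ ω', wordTrace (fun a => localTerm (K a) (G a ω')) w ∂P‖ ^ 2 ∂P : ℝ) : ℂ) =
        ((S / ((d : ℝ) ^ n) ^ 2 : ℝ) : ℂ) := by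
      rw [h1]
      simp only [h2]
      simp only [wordTrace_succ_eq, div_mul_div_comm, integral_div]
      rw [← sub_div, h3]
      push_cast
      rw [pow_two]
    exact_mod_cast this
  rw [h4]
  have h5 : S ≤ (pairingsOn (Finset.univ : Finset (Fin (k + 1) ⊕ Fin (k + 1)))).card *
      (((d : ℝ) ^ n) ^ 2 / d ^ 2) := by
    rw [hS, ← nsmul_eq_mul]
    refine (Finset.sum_le_card_nsmul _ _ _ fun σ hσ => ?_).trans
      (nsmul_le_nsmul_left (by positivity) (Finset.card_filter_le _ _))
    obtain ⟨h6, h7⟩ := Finset.mem_filter.1 hσ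
    exact pairWeight_sumCongr_finRotate_le hK hd (mem_pairingsOn.1 h6).1 h7
  rw [div_le_iff₀ (by positivity)]
  refine h5.trans (le_of_eq ?_)
  field_simp

lemma tendsto_pairWeight {k : ℕ} (w : Fin (k + 1) → Fin m) (σ : Equiv.Perm (Fin (k + 1)))
    [Decidable (IsLocallyNoncrossing K w σ)] :
    Tendsto (fun d : ℕ => pairWeight K d (√d) (finRotate (k + 1)) w σ / (d : ℝ) ^ n) atTop
      (𝓝 (if IsLocallyNoncrossing K w σ then 1 else 0)) := by
  split_ifs with h
  · refine tendsto_const_nhds.congr' ?_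
    filter_upwards [eventually_gt_atTop 0] with d hd
    have hd0 : (0 : ℝ) < d := Nat.cast_pos.2 hd
    rw [pairWeight_finRotate_of_noncrossing hd h, div_self (by positivity)]
  · refine tendsto_of_tendsto_of_tendsto_of_le_of_le' tendsto_const_nhds
      tendsto_inv_atTop_nhds_zero_nat
      (Eventually.of_forall fun d => div_nonneg (pairWeight_nonneg _ _ _ (Real.sqrt_nonneg _))
        (by positivity)) ?_
    filter_upwards [eventually_gt_atTop 0] with d hd
    have hd0 : (0 : ℝ) < d := Nat.cast_pos.2 hd
    rw [div_le_iff₀ (by positivity)]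
    refine (pairWeight_finRotate_of_crossing hd h).trans (le_of_eq ?_)
    rw [div_eq_mul_inv, mul_comm]

variable {G : (d : ℕ) → (a : Fin m) → Ω → Matrix (SiteIndex (K a) d) (SiteIndex (K a) d) ℂ}

lemma tendsto_integral_wordTrace (hGUE : ∀ d a, IsGUE (G d a) P)
    (hIndep : ∀ d, iIndepFun (fun (a : Fin m) (ω : Ω) (p : SiteIndex (K a) d × SiteIndex (K a) d) =>
      G d a ω p.1 p.2) P) {k : ℕ} (w : Fin k → Fin m) :
    Tendsto (fun d : ℕ => ∫ ω, wordTrace (fun a => localTerm (K a) (G d a ω)) w ∂P) atTop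
      (𝓝 ((epsNC₂ (epsilonMatrix K) w).card : ℂ)) := by
  classical
  rw [card_epsNC₂]
  rcases k with _ | k
  · simp only [wordTrace_fin_zero, integral_const, probReal_univ, one_smul]
    have h1 : ((pairingsOn (Finset.univ : Finset (Fin 0))).filter
        (IsLocallyNoncrossing K w)).card = 1 := by
      rw [Finset.card_eq_one]
      refine ⟨1, Finset.eq_singleton_iff_unique_mem.2 ⟨Finset.mem_filter.2 ⟨mem_pairingsOn.2
        ⟨one_mul 1, Subsingleton.elim _ _⟩, fun l => l.elim0, fun s i => i.elim0⟩,
        fun σ _ => Subsingleton.elim _ _⟩⟩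
    rw [h1, Nat.cast_one]
    refine tendsto_const_nhds.congr' ?_
    -- The trace of the empty word is 1 only for `d > 0`; at `d = 0` it can be 0 / 0 = 0.
    filter_upwards [eventually_gt_atTop 0] with d hd
    have hd0 : (d : ℂ) ≠ 0 := Nat.cast_ne_zero.2 hd.ne'
    simp [hd0]
  · have h1 : ∀ d : ℕ, ∫ ω, wordTrace (fun a => localTerm (K a) (G d a ω)) w ∂P =
        ((∑ σ ∈ pairingsOn Finset.univ,
          pairWeight K d (√d) (finRotate (k + 1)) w σ / (d : ℝ) ^ n : ℝ) : ℂ) := by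
      intro d
      simp only [wordTrace_succ_eq, integral_div]
      rw [integral_cyclicSum (hGUE d) (hIndep d) (Real.mul_self_sqrt (Nat.cast_nonneg d)),
        ← Finset.sum_div]
      push_cast
      rfl
    have h2 : (((pairingsOn Finset.univ).filter (IsLocallyNoncrossing K w)).card : ℂ) =
        ((∑ σ ∈ pairingsOn Finset.univ, (if IsLocallyNoncrossing K w σ then 1 else 0) : ℝ) : ℂ) := by
      rw [Finset.sum_boole]
      push_cast
      rfl
    simp only [h1]
    rw [h2]
    exact (Complex.continuous_ofReal.tendsto _).comp
      (tendsto_finsetSum _ fun σ _ => tendsto_pairWeight w σ)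

lemma isBigO_variance_wordTrace (hK : ∀ a, (K a).Nonempty) (hGUE : ∀ d a, IsGUE (G d a) P)
    (hIndep : ∀ d, iIndepFun (fun (a : Fin m) (ω : Ω) (p : SiteIndex (K a) d × SiteIndex (K a) d) =>
      G d a ω p.1 p.2) P) {k : ℕ} (w : Fin k → Fin m) :
    (fun d : ℕ => ∫ ω, ‖wordTrace (fun a => localTerm (K a) (G d a ω)) w -
        ∫ ω', wordTrace (fun a => localTerm (K a) (G d a ω')) w ∂P‖ ^ 2 ∂P)
      =O[atTop] (fun d : ℕ => ((d : ℝ) ^ 2)⁻¹) := by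
  rcases k with _ | k
  · simp only [wordTrace_fin_zero, integral_const, probReal_univ, one_smul, sub_self, norm_zero]
    simpa using isBigO_zero _ _
  · refine IsBigO.of_bound
      (pairingsOn (Finset.univ : Finset (Fin (k + 1) ⊕ Fin (k + 1)))).card ?_
    filter_upwards [eventually_gt_atTop 0] with d hd
    rw [Real.norm_of_nonneg (integral_nonneg fun ω => by positivity),
      Real.norm_of_nonneg (by positivity)]
    exact variance_wordTrace_le hK hd (hGUE d) (hIndep d) w

end WordTraces

/-! ### Almost sure convergence -/

/-- A sequence of square integrable random variables whose expectations converge and whose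
variances are `O(d⁻²)` converges almost surely. -/
theorem ae_tendsto_of_variance_isBigO {Ω : Type*} [MeasurableSpace Ω] {P : Measure Ω}
    [IsProbabilityMeasure P] {Y : ℕ → Ω → ℂ} (hY : ∀ d, MemLp (Y d) 2 P) {L : ℂ}
    (hL : Tendsto (fun d => ∫ ω, Y d ω ∂P) atTop (𝓝 L))
    (hvar : (fun d : ℕ => ∫ ω, ‖Y d ω - ∫ ω', Y d ω' ∂P‖ ^ 2 ∂P)
      =O[atTop] (fun d : ℕ => ((d : ℝ) ^ 2)⁻¹)) :
    ∀ᵐ ω ∂P, Tendsto (fun d => Y d ω) atTop (𝓝 L) := by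
  have hint : ∀ d, Integrable (fun ω => ‖Y d ω - ∫ ω', Y d ω' ∂P‖ ^ 2) P := fun d =>
    ((hY d).sub (memLp_const _)).integrable_norm_pow (by norm_num)
  have hsum : Summable fun d : ℕ => ∫ ω, ‖Y d ω - ∫ ω', Y d ω' ∂P‖ ^ 2 ∂P :=
    summable_of_isBigO_nat (Real.summable_nat_pow_inv.2 (by norm_num)) hvar
  have hmeas : ∀ d, AEMeasurable (fun ω => ENNReal.ofReal (‖Y d ω - ∫ ω', Y d ω' ∂P‖ ^ 2)) P :=
    fun d => (hint d).aestronglyMeasurable.aemeasurable.ennreal_ofReal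
  -- Summable variances make the sum of the squared deviations integrable, hence almost surely
  -- finite, so its terms tend to 0. No relation between different `d` is used.
  have hfin : ∫⁻ ω, ∑' d, ENNReal.ofReal (‖Y d ω - ∫ ω', Y d ω' ∂P‖ ^ 2) ∂P ≠ ⊤ := by
    rw [lintegral_tsum hmeas]
    have h1 : ∀ d, ∫⁻ ω, ENNReal.ofReal (‖Y d ω - ∫ ω', Y d ω' ∂P‖ ^ 2) ∂P =
        ENNReal.ofReal (∫ ω, ‖Y d ω - ∫ ω', Y d ω' ∂P‖ ^ 2 ∂P) := fun d =>
      (ofReal_integral_eq_lintegral_ofReal (hint d) (ae_of_all _ fun ω => by positivity)).symm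
    simp only [h1]
    rw [← ENNReal.ofReal_tsum_of_nonneg (fun d => integral_nonneg fun ω => by positivity) hsum]
    exact ENNReal.ofReal_ne_top
  filter_upwards [ae_lt_top' (AEMeasurable.tsum hmeas) hfin] with ω hω
  have h2 := ENNReal.tendsto_atTop_zero_of_tsum_ne_top hω.ne
  have h3 : Tendsto (fun d => ‖Y d ω - ∫ ω', Y d ω' ∂P‖ ^ 2) atTop (𝓝 0) := by
    have := (ENNReal.tendsto_toReal ENNReal.zero_ne_top).comp h2
    simpa [Function.comp_def, ENNReal.toReal_ofReal] using this
  have h4 : Tendsto (fun d => ‖Y d ω - ∫ ω', Y d ω' ∂P‖) atTop (𝓝 0) := by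
    have := h3.sqrt
    simpa [Real.sqrt_sq] using this
  have h5 := (tendsto_zero_iff_norm_tendsto_zero.2 h4).add hL
  simpa using h5

theorem mainTheorem4 {Ω : Type*} [MeasurableSpace Ω] (P : Measure Ω) [IsProbabilityMeasure P]
    (n m : ℕ) (K : Fin m → Finset (Fin n)) (hK : ∀ a, (K a).Nonempty)
    (G : (d : ℕ) → (a : Fin m) → Ω → Matrix (SiteIndex (K a) d) (SiteIndex (K a) d) ℂ)
    (hGUE : ∀ d a, IsGUE (G d a) P)
    (hIndep : ∀ d, iIndepFun (fun (a : Fin m) (ω : Ω) (p : SiteIndex (K a) d × SiteIndex (K a) d) =>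
      G d a ω p.1 p.2) P) :
    (∀ᵐ ω ∂P, ∀ (k : ℕ) (w : Fin k → Fin m),
      Tendsto (fun d : ℕ => wordTrace (fun a => localTerm (K a) (G d a ω)) w) atTop
        (𝓝 (∑ _α ∈ epsNC₂ (epsilonMatrix K) w, 1))) ∧
    ∀ (k : ℕ) (w : Fin k → Fin m),
      (∀ d : ℕ, MemLp (fun ω => wordTrace (fun a => localTerm (K a) (G d a ω)) w) 2 P) ∧
      (fun d : ℕ => ∫ ω, ‖wordTrace (fun a => localTerm (K a) (G d a ω)) w -
          ∫ ω', wordTrace (fun a => localTerm (K a) (G d a ω')) w ∂P‖ ^ 2 ∂P)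
        =O[atTop] (fun d : ℕ => ((d : ℝ) ^ 2)⁻¹) := by
  have hmem : ∀ (k : ℕ) (w : Fin k → Fin m) (d : ℕ),
      MemLp (fun ω => wordTrace (fun a => localTerm (K a) (G d a ω)) w) 2 P :=
    fun k w d => memLp_wordTrace (hGUE d) w 2 (by simp)
  refine ⟨?_, fun k w => ⟨hmem k w, isBigO_variance_wordTrace hK hGUE hIndep w⟩⟩
  -- There are only countably many words, so one null set serves them all.
  rw [ae_all_iff]
  intro k
  rw [ae_all_iff]
  intro w
  rw [Finset.sum_const, nsmul_eq_mul, mul_one]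
  exact ae_tendsto_of_variance_isBigO (hmem k w) (tendsto_integral_wordTrace hGUE hIndep w)
    (isBigO_variance_wordTrace hK hGUE hIndep w)
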